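/- Let $d,n,N\ge 0$ be integers. A near horizon extremal geometry (NHEG) on a coordinate patch consists of a connected open set $U\subset\mathbb R^d$, a smooth Lorentzian metric $g$ and smooth 1-forms (abelian gauge fields) $A^{(p)}$, $1\le p\le N$, on $U$, with local $SL(2,\mathbb R)\times U(1)^n$ isometry, i.e. with smooth Killing vector fields $\xi_-,\xi_0,\xi_+,\mathrm m_1,\dots,\mathrm m_n$ of $g$ such that $$[\xi_0,\xi_-]=-\xi_-,\quad [\xi_0,\xi_+]=\xi_+,\quad [\xi_-,\xi_+]=\xi_0,\quad [\xi_a,\mathrm m_i]=0,\quad [\mathrm m_i,\mathrm m_j]=0,$$ $\mathscr L_{\xi_-}A^{(p)}=\mathscr L_{\xi_0}A^{(p)}=\mathscr L_{\mathrm m_i}A^{(p)}=0$, and $\mathscr L_{\xi_+}A^{(p)}=\mathrm d\Lambda^p$ for some smooth functions $\Lambda^p$. At each point $\xi_-,\xi_0,\mathrm m_1,\dots,\mathrm m_n$ are linearly independent and their span contains $\xi_+$ and a timelike vector (the orbits are $(n+2)$-dimensional and timelike, and $U$ lies in a Poincaré patch), and $g$ is positive definite on the span of the $\mathrm m_i$.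 Call smooth functions $t,r$ on $U$, $r\neq0$, Poincaré coordinates if $\xi_-$ acts on $(t,r)$ as $\partial_t$, $\xi_0$ as $t\partial_t-r\partial_r$, $\xi_+$ as $\frac12(t^2+\frac1{r^2})\partial_t-tr\,\partial_r$, and every $\mathrm m_i$ as $0$. Given these, define functions $k^i$ and $e^p$ on $U$ by $$g(\xi_-,\mathrm m_j)=r\sum_i k^i\, g(\mathrm m_i,\mathrm m_j),\qquad e^p=\sum_i k^iA^{(p)}(\mathrm m_i)-\frac{A^{(p)}(\xi_-)}{r}$$ (so $g_{t\varphi^j}=r k^i g_{\varphi^i\varphi^j}$ and $A^{(p)}_t=r(A^{(p)}_{\varphi^i}k^i-e^p)$ where $\partial_t=\xi_-$, $\partial_{\varphi^i}=\mathrm m_i$). Put $\mathrm n^-(t,r)=-\frac{t^2r^2-1}{2r}$, $\mathrm n^0(t,r)=tr$, $\mathrm n^+(t,r)=-r$. **NHEG zeroth law.** Every NHEG has Poincaré coordinates with $r>0$. For any Poincaré coordinates $(t,r)$: 1. the functions $k^i$ and $e^p$ are constant on $U$; 2. $\mathrm n^a(t,r)\,\xi_a=\sum_i k^i\mathrm m_i$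 on $U$, i.e. the constants $k^i$ are also those of $\xi_+=\frac12(\frac1{r^2}-t^2)\xi_-+t\,\xi_0-\frac1r\sum_i k^i\mathrm m_i$; 3. for all $t_{\mathcal H}\in\mathbb R$, $r_{\mathcal H}\ne0$, the surface gravity of the Killing vector $\zeta_{\mathcal H}=\mathrm n^a(t_{\mathcal H},r_{\mathcal H})\,\xi_a-\sum_i k^i\mathrm m_i$, i.e. the nonnegative root $$\kappa=\sqrt{-\tfrac18(\mathrm d\zeta_{\mathcal H})_{\alpha\beta}(\mathrm d\zeta_{\mathcal H})^{\alpha\beta}},$$ equals $1$ at every point of the horizon $\mathcal N_{\mathcal H}=\{t+\frac1r=t_{\mathcal H}+\frac1{r_{\mathcal H}}\}\cup\{t-\frac1r=t_{\mathcal H}-\frac1{r_{\mathcal H}}\}$, in particular on $\mathcal H=\{t=t_{\mathcal H},\,r=r_{\mathcal H}\}$. -/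

import Mathlib

open scoped ContDiff

noncomputable section

namespace NearHorizon

/-- Coordinate space of a `d`-dimensional spacetime patch. -/
abbrev Pt (d : ℕ) : Type := Fin d → ℝ

/-- Vector fields in coordinates. -/
abbrev VField (d : ℕ) : Type := Pt d → Pt d

/-- Covector fields (1-forms) in coordinates. -/
abbrev OneForm (d : ℕ) : Type := Pt d → (Pt d →L[ℝ] ℝ)

/-- Covariant 2-tensor fields in coordinates. -/
abbrev TwoTensor (d : ℕ) : Type := Pt d → (Pt d →L[ℝ] Pt d →L[ℝ] ℝ)

/-- Derivative `X(f)` of a function along a vector field. -/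
def along {d : ℕ} (X : VField d) (f : Pt d → ℝ) (x : Pt d) : ℝ :=
  fderiv ℝ f x (X x)

/-- Lie derivative of a covariant 2-tensor:
`(L_X g)_{μν} = X^ρ ∂_ρ g_{μν} + ∂_μ X^ρ g_{ρν} + ∂_ν X^ρ g_{μρ}`. -/
def lieTwo {d : ℕ} (X : VField d) (g : TwoTensor d) (x v w : Pt d) : ℝ :=
  fderiv ℝ g x (X x) v w + g x (fderiv ℝ X x v) w + g x v (fderiv ℝ X x w)

/-- Lie derivative of a 1-form: `(L_X A)_μ = X^ρ ∂_ρ A_μ + ∂_μ X^ρ A_ρ`. -/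
def lieOne {d : ℕ} (X : VField d) (A : OneForm d) (x v : Pt d) : ℝ :=
  fderiv ℝ A x (X x) v + A x (fderiv ℝ X x v)

/-- Exterior derivative of a 1-form: `(dA)_{μν} = ∂_μ A_ν - ∂_ν A_μ`. -/
def extDerivOne {d : ℕ} (A : OneForm d) (x v w : Pt d) : ℝ :=
  fderiv ℝ A x v w - fderiv ℝ A x w v

/-- The 1-form `X_ν = g_{νρ} X^ρ` (for symmetric `g`). -/
def lower {d : ℕ} (g : TwoTensor d) (X : VField d) : OneForm d :=
  fun x => g x (X x)

/-- Coordinate basis vector `∂_μ`. -/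
def basisVec {d : ℕ} (μ : Fin d) : Pt d := Pi.single μ 1

/-- Components `g^{μν}` of the inverse metric. -/
def invMetric {d : ℕ} (g : TwoTensor d) (x : Pt d) : Matrix (Fin d) (Fin d) ℝ :=
  (Matrix.of fun μ ν => g x (basisVec μ) (basisVec ν))⁻¹

/-- The scalar `(dζ)_{αβ} (dζ)^{αβ}` for the 1-form metrically dual to `ζ`. -/
def extDerivSq {d : ℕ} (g : TwoTensor d) (ζ : VField d) (x : Pt d) : ℝ :=
  ∑ α, ∑ β, ∑ μ, ∑ ν, invMetric g x α μ * invMetric g x β ν *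
    extDerivOne (lower g ζ) x (basisVec α) (basisVec β) *
    extDerivOne (lower g ζ) x (basisVec μ) (basisVec ν)

/-- Surface gravity: the nonnegative root of `κ² = -(1/8) (dζ)_{αβ} (dζ)^{αβ}`. -/
def surfaceGravity {d : ℕ} (g : TwoTensor d) (ζ : VField d) (x : Pt d) : ℝ :=
  Real.sqrt (-(1 / 8) * extDerivSq g ζ x)

/-- A symmetric bilinear form of signature `(-,+,…,+)`. -/
def IsLorentzian {d : ℕ} (B : Pt d →L[ℝ] Pt d →L[ℝ] ℝ) : Prop :=
  (∀ v w, B v w = B w v) ∧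
    ∃ v, B v v < 0 ∧ ∀ w, B v w = 0 → w ≠ 0 → 0 < B w w

/-- A near horizon extremal geometry on a coordinate patch `U` of dimension `d`: a Lorentzian
metric and `N` abelian gauge fields with local `SL(2,ℝ) × U(1)^n` isometry.  The `SL(2,ℝ)`
generators are `ξm = ξ₋`, `ξ0 = ξ₀`, `ξp = ξ₊`; the `U(1)^n` generators are `m i`. -/
structure NHEG (d n N : ℕ) where
  U : Set (Pt d)
  isOpen_U : IsOpen U
  isConnected_U : IsConnected U
  g : TwoTensor d
  A : Fin N → OneForm d
  ξm : VField d
  ξ0 : VField d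
  ξp : VField d
  m : Fin n → VField d
  smooth_g : ContDiffOn ℝ ∞ g U
  smooth_A : ∀ p, ContDiffOn ℝ ∞ (A p) U
  smooth_ξm : ContDiffOn ℝ ∞ ξm U
  smooth_ξ0 : ContDiffOn ℝ ∞ ξ0 U
  smooth_ξp : ContDiffOn ℝ ∞ ξp U
  smooth_m : ∀ i, ContDiffOn ℝ ∞ (m i) U
  lorentzian : ∀ x ∈ U, IsLorentzian (g x)
  -- the Lie algebra `sl(2,ℝ) ⊕ u(1)^n`
  bracket_0m : ∀ x ∈ U, VectorField.lieBracket ℝ ξ0 ξm x = -ξm x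
  bracket_0p : ∀ x ∈ U, VectorField.lieBracket ℝ ξ0 ξp x = ξp x
  bracket_mp : ∀ x ∈ U, VectorField.lieBracket ℝ ξm ξp x = ξ0 x
  bracket_ξm_m : ∀ i, ∀ x ∈ U, VectorField.lieBracket ℝ ξm (m i) x = 0
  bracket_ξ0_m : ∀ i, ∀ x ∈ U, VectorField.lieBracket ℝ ξ0 (m i) x = 0
  bracket_ξp_m : ∀ i, ∀ x ∈ U, VectorField.lieBracket ℝ ξp (m i) x = 0
  bracket_m_m : ∀ i j, ∀ x ∈ U, VectorField.lieBracket ℝ (m i) (m j) x = 0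
  -- all generators are Killing vectors
  killing_ξm : ∀ x ∈ U, ∀ v w, lieTwo ξm g x v w = 0
  killing_ξ0 : ∀ x ∈ U, ∀ v w, lieTwo ξ0 g x v w = 0
  killing_ξp : ∀ x ∈ U, ∀ v w, lieTwo ξp g x v w = 0
  killing_m : ∀ i, ∀ x ∈ U, ∀ v w, lieTwo (m i) g x v w = 0
  -- the gauge fields are invariant, under `ξ₊` up to a gauge transformation
  gauge_ξm : ∀ p, ∀ x ∈ U, ∀ v, lieOne ξm (A p) x v = 0
  gauge_ξ0 : ∀ p, ∀ x ∈ U, ∀ v, lieOne ξ0 (A p) x v = 0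
  gauge_m : ∀ p i, ∀ x ∈ U, ∀ v, lieOne (m i) (A p) x v = 0
  gauge_ξp : ∀ p, ∃ Λ : Pt d → ℝ, ContDiffOn ℝ ∞ Λ U ∧
    ∀ x ∈ U, ∀ v, lieOne ξp (A p) x v = fderiv ℝ Λ x v
  -- the orbits of the isometry group are `(n+2)`-dimensional and timelike, with spacelike
  -- `U(1)^n` directions; `ξ₋, ξ₀, m i` frame them on the Poincaré patch
  linearIndependent : ∀ x ∈ U,
    LinearIndependent ℝ (Sum.elim ![ξm x, ξ0 x] (fun i => m i x))
  ξp_mem_orbit : ∀ x ∈ U,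
    ξp x ∈ Submodule.span ℝ (Set.range (Sum.elim ![ξm x, ξ0 x] (fun i => m i x)))
  orbit_timelike : ∀ x ∈ U,
    ∃ v ∈ Submodule.span ℝ (Set.range (Sum.elim ![ξm x, ξ0 x] (fun i => m i x))), g x v v < 0
  m_spacelike : ∀ x ∈ U, ∀ c : Fin n → ℝ, c ≠ 0 →
    0 < g x (∑ i, c i • m i x) (∑ i, c i • m i x)

namespace NHEG

variable {d n N : ℕ} (G : NHEG d n N)

/-- `t, r` are the Poincaré coordinates of the `AdS₂` sector: in coordinates
`(t, r, θ^α, φ^i)` the isometry generators are `ξ₋ = ∂_t`, `ξ₀ = t ∂_t - r ∂_r`,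
`ξ₊ = (1/2)(t² + 1/r²) ∂_t - t r ∂_r + (terms along ∂_{φ^i})`, `m_i = ∂_{φ^i}`. -/
structure IsPoincare (t r : Pt d → ℝ) : Prop where
  smooth_t : ContDiffOn ℝ ∞ t G.U
  smooth_r : ContDiffOn ℝ ∞ r G.U
  r_ne : ∀ x ∈ G.U, r x ≠ 0
  ξm_t : ∀ x ∈ G.U, along G.ξm t x = 1
  ξm_r : ∀ x ∈ G.U, along G.ξm r x = 0
  ξ0_t : ∀ x ∈ G.U, along G.ξ0 t x = t x
  ξ0_r : ∀ x ∈ G.U, along G.ξ0 r x = -r x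
  ξp_t : ∀ x ∈ G.U, along G.ξp t x = (1 / 2) * (t x ^ 2 + 1 / r x ^ 2)
  ξp_r : ∀ x ∈ G.U, along G.ξp r x = -(t x * r x)
  m_t : ∀ i, ∀ x ∈ G.U, along (G.m i) t x = 0
  m_r : ∀ i, ∀ x ∈ G.U, along (G.m i) r x = 0

/-- The components `g_{φ^i φ^j}`. -/
def gPhiPhi (x : Pt d) : Matrix (Fin n) (Fin n) ℝ :=
  Matrix.of fun i j => G.g x (G.m i x) (G.m j x)

/-- The functions `k^i` of the metric, i.e. the solution of
`g_{tφ^j} = r k^i g_{φ^i φ^j}` (with `∂_t = ξ₋`). -/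
def kPot (r : Pt d → ℝ) (x : Pt d) : Fin n → ℝ :=
  (G.gPhiPhi x)⁻¹.mulVec fun j => G.g x (G.ξm x) (G.m j x) / r x

/-- The functions `e^p` of the gauge fields, i.e. the solution of
`A_t = r (A_{φ^i} k^i - e^p)`. -/
def ePot (r : Pt d → ℝ) (p : Fin N) (x : Pt d) : ℝ :=
  ∑ i, G.A p x (G.m i x) * G.kPot r x i - G.A p x (G.ξm x) / r x

/-- The combination `n^a ξ_a`, where `n^- = -(t²r² - 1)/(2r)`, `n^0 = t r`, `n^+ = -r` are
evaluated at the point `(t, r) = (t₀, r₀)` of `AdS₂`. -/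
def nXi (t₀ r₀ : ℝ) : VField d := fun x =>
  (-(t₀ ^ 2 * r₀ ^ 2 - 1) / (2 * r₀)) • G.ξm x + (t₀ * r₀) • G.ξ0 x + (-r₀) • G.ξp x

/-- The horizon Killing vector `ζ_H = n_H^a ξ_a - k^i m_i` of the surface `t = tH, r = rH`. -/
def zetaH (k : Fin n → ℝ) (tH rH : ℝ) : VField d := fun x =>
  G.nXi tH rH x - ∑ i, k i • G.m i x

/-- The bifurcate Killing horizon `t + 1/r = tH + 1/rH` or `t - 1/r = tH - 1/rH`; it contains
the surface `t = tH, r = rH`. -/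
def horizon (t r : Pt d → ℝ) (tH rH : ℝ) : Set (Pt d) :=
  {x ∈ G.U | t x + 1 / r x = tH + 1 / rH ∨ t x - 1 / r x = tH - 1 / rH}

end NHEG

end NearHorizon

end

open scoped ContDiff

noncomputable section

namespace NearHorizon

/-! Everything is read off from the expansion `ξ₊ = a ξ₋ + b ξ₀ + c^i m_i` on the orbits, whose
coefficients are unique and smooth. The brackets fix the derivatives of `a, b, c` along the
generators (`along_ξm`, `along_ξ0`, `along_m`). Subtracting the Killing equations of the frame from
that of `ξ₊` leaves `da ⊙ ξ₋♭ + db ⊙ ξ₀♭ + dc^i ⊙ m_i♭ = 0` (`killing_coeffs`). Tangentially, this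
gives an orthogonal frame `radial`, `temporal` complementary to the `m_i`, and the signature forces
`2a + b² > 0`. With one normal slot, it shows that `a, b, c` have no derivative normal to the orbits
(`fderiv_isPerp`).

Hence `t = b`, `r = (2a + b²)^(-1/2)` are Poincaré coordinates. In any Poincaré coordinates `r c^i`
has zero differential, so `c^i = -k^i / r` with constant `k^i` (`exists_k`). Orthogonality of
`temporal` to the `m_j` identifies these with the metric `k^i`, and the expansion multiplied by `-r`
is the identity for `n^a ξ_a`. For `e^p`, tangential derivatives vanish by invariance; the normal
ones vanish by taking `d` of `L_{ξ₊} A = dΛ` (`fderiv_gauge_isPerp`).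

For the surface gravity, at a horizon point the vector `w + e`, with `w` radial and `e` a rescaled
`temporal`, is null and is the value of a Killing field with constant coefficients. Cartan's formula
along Killing fields, together with an isotropy argument for the purely normal components
(`extDerivOne_perp`), reduces `dζ` to `c e ∧ w + (w + e) ∧ σ` up to normalisation. The `σ` term
drops out of the square (`extDerivSq_eq`), and `c = ±2` gives `-8`. -/

/-! ### Lorentzian linear algebra and squares of two-forms -/

/-- In a Lorentzian form, every nonzero vector orthogonal to a timelike one is spacelike. -/
theorem IsLorentzian.pos_of_orthogonal {d : ℕ} {B : Pt d →L[ℝ] Pt d →L[ℝ] ℝ}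
    (hB : IsLorentzian B) {v w : Pt d} (hv : B v v < 0) (hvw : B v w = 0) (hw : w ≠ 0) :
    0 < B w w := by
  obtain ⟨hsymm, v₀, hv₀, hpos⟩ := hB
  by_contra hle
  push Not at hle
  have hv0 : v ≠ 0 := by rintro rfl; simp at hv
  have hβ : B v₀ v ≠ 0 := fun h => by linarith [hpos v h hv0]
  have hwv : B w v = 0 := by rw [hsymm, hvw]
  -- This combination is orthogonal to the reference vector `v₀`, hence spacelike if nonzero,
  -- although its square is a nonpositive combination of `B v v` and `B w w`.
  set u : Pt d := B v₀ w • v - B v₀ v • w with hu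
  have h1 : B v₀ u = 0 := by simp [hu]; ring
  have h2 : B u u = (B v₀ w) ^ 2 * B v v + (B v₀ v) ^ 2 * B w w := by
    simp [hu, hvw, hwv]; ring
  have h3 : u ≠ 0 := by
    intro h0
    have h4 : B v u = 0 := by rw [h0]; simp
    have h5 : B v₀ w = 0 := by
      simp [hu, hvw] at h4
      exact h4.resolve_right hv.ne
    rw [hu, h5] at h0
    simp at h0
    exact h0.elim hβ hw
  have h6 := hpos u h1 h3
  rw [h2] at h6
  nlinarith [sq_nonneg (B v₀ w), sq_nonneg (B v₀ v)]

theorem IsLorentzian.eq_zero_of_forall {d : ℕ} {B : Pt d →L[ℝ] Pt d →L[ℝ] ℝ}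
    (hB : IsLorentzian B) {w : Pt d} (h : ∀ v, B v w = 0) : w = 0 := by
  obtain ⟨-, v₀, -, hpos⟩ := hB
  by_contra hw
  exact (hpos w (h v₀) hw).ne' (h w)

/-- Expansion of a vector in the coordinate basis. -/
theorem sum_smul_basisVec {d : ℕ} (v : Pt d) : ∑ μ, v μ • basisVec μ = v := by
  ext ν
  simp [basisVec, Finset.sum_apply, Pi.single_apply]

theorem clm_apply_eq_sum {d : ℕ} (α : Pt d →L[ℝ] ℝ) (v : Pt d) :
    α v = ∑ μ, v μ * α (basisVec μ) := by
  conv_lhs => rw [← sum_smul_basisVec v]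
  simp

/-- The contraction of two covectors with the inverse metric. -/
def covPairing {d : ℕ} (g : TwoTensor d) (x : Pt d) (α β : Pt d →L[ℝ] ℝ) : ℝ :=
  ∑ μ, ∑ ν, invMetric g x μ ν * α (basisVec μ) * β (basisVec ν)

/-- The Gram matrix is invertible because a kernel vector would be orthogonal to everything. Raising
then undoes lowering, so contractions with a lowered vector need no components. -/
theorem covPairing_lower_left {d : ℕ} {g : TwoTensor d} {x : Pt d} (hg : IsLorentzian (g x))
    (v : Pt d) (β : Pt d →L[ℝ] ℝ) : covPairing g x (g x v) β = β v := by
  set M : Matrix (Fin d) (Fin d) ℝ := Matrix.of fun μ ν => g x (basisVec μ) (basisVec ν) with hM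
  have hdet : IsUnit M.det := by
    rw [isUnit_iff_ne_zero]
    intro h0
    obtain ⟨u, hu, hMu⟩ := Matrix.exists_mulVec_eq_zero_iff.2 h0
    refine hu (hg.eq_zero_of_forall fun v => ?_)
    have h1 : ∀ μ, g x (basisVec μ) u = 0 := fun μ => by
      have := congrFun hMu μ
      simp only [Matrix.mulVec, dotProduct, hM, Matrix.of_apply, Pi.zero_apply] at this
      rw [clm_apply_eq_sum, ← this]
      exact Finset.sum_congr rfl fun _ _ => mul_comm _ _
    rw [hg.1, clm_apply_eq_sum]
    exact Finset.sum_eq_zero fun μ _ => by rw [hg.1, h1, mul_zero]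
  have hMN : M * M⁻¹ = 1 := Matrix.mul_nonsing_inv _ hdet
  have key : ∀ ν, ∑ μ, M⁻¹ μ ν * g x v (basisVec μ) = v ν := fun ν => by
    have h1 : ∀ μ, g x v (basisVec μ) = ∑ ρ, v ρ * M ρ μ := fun μ => by
      rw [hg.1, clm_apply_eq_sum]
      exact Finset.sum_congr rfl fun ρ _ => by rw [hg.1]; rfl
    calc ∑ μ, M⁻¹ μ ν * g x v (basisVec μ)
        = ∑ μ, ∑ ρ, v ρ * (M ρ μ * M⁻¹ μ ν) := by
          refine Finset.sum_congr rfl fun μ _ => ?_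
          rw [h1, Finset.mul_sum]
          exact Finset.sum_congr rfl fun ρ _ => by ring
      _ = ∑ ρ, v ρ * (M * M⁻¹) ρ ν := by
          rw [Finset.sum_comm]
          exact Finset.sum_congr rfl fun ρ _ => by rw [Matrix.mul_apply, Finset.mul_sum]
      _ = v ν := by simp [hMN, Matrix.one_apply]
  unfold covPairing invMetric
  rw [Finset.sum_comm, clm_apply_eq_sum β v]
  refine Finset.sum_congr rfl fun ν _ => ?_
  rw [← key ν, Finset.sum_mul]

theorem covPairing_comm {d : ℕ} {g : TwoTensor d} {x : Pt d} (hg : IsLorentzian (g x))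
    (α β : Pt d →L[ℝ] ℝ) : covPairing g x α β = covPairing g x β α := by
  have hsymm : ∀ μ ν, invMetric g x μ ν = invMetric g x ν μ := by
    intro μ ν
    have : (invMetric g x).transpose = invMetric g x := by
      unfold invMetric
      rw [Matrix.transpose_nonsing_inv]
      congr 1
      ext i j
      exact hg.1 _ _
    rw [← this, Matrix.transpose_apply, this]
  unfold covPairing
  rw [Finset.sum_comm]
  refine Finset.sum_congr rfl fun ν _ => Finset.sum_congr rfl fun μ _ => ?_
  rw [hsymm]; ring

/-- The full contraction of a sum of tensor products of covectors with itself. -/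
theorem sum_contraction_tensor {d m : ℕ} (P : Matrix (Fin d) (Fin d) ℝ) (a b : Fin m → Fin d → ℝ) :
    ∑ α, ∑ β, ∑ μ, ∑ ν, P α μ * P β ν * (∑ i, a i α * b i β) * (∑ j, a j μ * b j ν) =
      ∑ i, ∑ j, (∑ α, ∑ μ, P α μ * a i α * a j μ) * (∑ β, ∑ ν, P β ν * b i β * b j ν) := by
  have h : ∀ i j, (∑ α, ∑ μ, P α μ * a i α * a j μ) * (∑ β, ∑ ν, P β ν * b i β * b j ν) =
      ∑ α, ∑ β, ∑ μ, ∑ ν, P α μ * P β ν * (a i α * b i β) * (a j μ * b j ν) := by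
    intro i j
    rw [Finset.sum_mul_sum]
    refine Finset.sum_congr rfl fun α _ => Finset.sum_congr rfl fun β _ => ?_
    rw [Finset.sum_mul_sum]
    exact Finset.sum_congr rfl fun μ _ => Finset.sum_congr rfl fun ν _ => by ring
  simp_rw [h]
  have h2 : ∀ α β μ ν, P α μ * P β ν * (∑ i, a i α * b i β) * (∑ j, a j μ * b j ν) =
      ∑ i, ∑ j, P α μ * P β ν * (a i α * b i β) * (a j μ * b j ν) := by
    intro α β μ ν
    rw [mul_assoc, Finset.sum_mul_sum, Finset.mul_sum]
    refine Finset.sum_congr rfl fun i _ => ?_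
    rw [Finset.mul_sum]
    exact Finset.sum_congr rfl fun j _ => by ring
  simp_rw [h2]
  -- Both sides become single sums over a sixfold product; the equivalence below moves the index
  -- pair `i, j` from the innermost to the outermost place.
  simp_rw [← Fintype.sum_prod_type']
  exact Fintype.sum_equiv
    ⟨fun x => (x.2.2.2.2.1, x.2.2.2.2.2, x.1, x.2.1, x.2.2.1, x.2.2.2.1),
      fun x => (x.2.2.1, x.2.2.2.1, x.2.2.2.2.1, x.2.2.2.2.2, x.1, x.2.1),
      fun _ => rfl, fun _ => rfl⟩ _ _ fun _ => rfl

/-- A two-form `c e♭ ∧ w♭ + (w + e)♭ ∧ σ` with `e, w` orthogonal of opposite norm and `σ`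
vanishing on `e, w` has square determined by its component along `e, w` alone. -/
theorem extDerivSq_eq {d : ℕ} {g : TwoTensor d} {ζ : VField d} {x : Pt d}
    (hg : IsLorentzian (g x)) {e w : Pt d} (hew : g x e w = 0) (hw : g x w w ≠ 0)
    (hee : g x e e = -g x w w)
    (hQ : ∀ z z', g x e z = 0 → g x w z = 0 → g x e z' = 0 → g x w z' = 0 →
      extDerivOne (lower g ζ) x z z' = 0)
    (hl : ∀ z, g x e z = 0 → g x w z = 0 → extDerivOne (lower g ζ) x (w + e) z = 0)
    {c : ℝ} (hc : extDerivOne (lower g ζ) x e w = c * g x w w) :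
    extDerivSq g ζ x = -2 * c ^ 2 := by
  set F : Pt d →L[ℝ] Pt d →L[ℝ] ℝ :=
    fderiv ℝ (lower g ζ) x - (fderiv ℝ (lower g ζ) x).flip with hF
  have hFe : ∀ v u, extDerivOne (lower g ζ) x v u = F v u := fun v u => rfl
  have hFs : ∀ v u, F u v = -F v u := fun v u => by rw [← hFe, ← hFe]; simp [extDerivOne]
  simp only [hFe] at hQ hl hc
  set q := g x w w with hq
  have hwe : g x w e = 0 := by rw [hg.1, hew]
  have hFww : F w w = 0 := by have := hFs w w; linarith
  have hFee : F e e = 0 := by have := hFs e e; linarith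
  have hFwe : F w e = -(c * q) := by rw [hFs, hc]
  -- Projection to the orthogonal complement of `e, w`; the plus sign comes from `g(e, e) = -q`. The
  -- covector `σ` is `F w` corrected so as to vanish on the plane of `e, w`.
  set pr : Pt d → Pt d := fun v => v - (g x w v / q) • w + (g x e v / q) • e with hpr
  set σ : Pt d →L[ℝ] ℝ := q⁻¹ • (F w - (F w e * -q⁻¹) • g x e) with hσ
  have hσw : σ w = 0 := by simp [hσ, hFww, hew]
  have hσe : σ e = 0 := by simp [hσ, hFwe, hee]; right; field_simp; ring
  have hdec : ∀ v u, F v u =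
      -(c / q) * (g x e v * g x w u) + (c / q) * (g x w v * g x e u)
        + g x (w + e) v * σ u - σ v * g x (w + e) u := by
    intro v u
    have hpe : ∀ v, g x e (pr v) = 0 := fun v => by simp [hpr, hew, hee]; field_simp; ring
    have hpw : ∀ v, g x w (pr v) = 0 := fun v => by simp [hpr, hwe, ← hq]; field_simp; ring
    have hσp : ∀ v, σ (pr v) = σ v := fun v => by simp [hpr, hσw, hσe]
    have hFp : ∀ v, F w (pr v) = q * σ v := fun v => by
      rw [← hσp]; simp [hσ, hpe]; field_simp
    have hFpe : ∀ v, F e (pr v) = -(q * σ v) := fun v => by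
      have := hl (pr v) (hpe v) (hpw v)
      simp only [map_add, add_apply, hFp] at this
      linarith
    have hv : ∀ v, v = pr v + (g x w v / q) • w - (g x e v / q) • e := fun v => by
      simp only [hpr]; abel
    conv_lhs => rw [hv v, hv u]
    simp only [map_add, map_sub, map_smul, add_apply,
      sub_apply, smul_apply, smul_eq_mul,
      hQ _ _ (hpe v) (hpw v) (hpe u) (hpw u), hFp, hFpe, hFww, hFee, hFwe, hc,
      hFs w (pr v), hFs e (pr v)]
    field_simp
    ring
  have h4 : ∀ v u, F v u = ∑ i, (![-(c / q) • g x e, (c / q) • g x w, g x (w + e), -σ] i) v *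
      (![g x w, g x e, σ, g x (w + e)] i) u := by
    intro v u
    rw [hdec, Fin.sum_univ_four]
    simp only [Matrix.cons_val_zero, Matrix.cons_val_one, Matrix.cons_val,
      smul_apply, smul_eq_mul, neg_apply]
    ring
  unfold extDerivSq
  simp only [hFe, h4]
  rw [sum_contraction_tensor (invMetric g x)
    (fun i α => (![-(c / q) • g x e, (c / q) • g x w, g x (w + e), -σ] i) (basisVec α))
    (fun i α => (![g x w, g x e, σ, g x (w + e)] i) (basisVec α))]
  change ∑ i, ∑ j, covPairing g x (![-(c / q) • g x e, (c / q) • g x w, g x (w + e), -σ] i)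
    (![-(c / q) • g x e, (c / q) • g x w, g x (w + e), -σ] j) *
    covPairing g x (![g x w, g x e, σ, g x (w + e)] i) (![g x w, g x e, σ, g x (w + e)] j) = _
  have hL := fun v β => covPairing_lower_left hg v β
  have hR : ∀ v β, covPairing g x β (g x v) = β v := fun v β => by rw [covPairing_comm hg, hL]
  simp only [Fin.sum_univ_four, Matrix.cons_val_zero, Matrix.cons_val_one, Matrix.cons_val,
    ← map_smul, hL, hR]
  -- Every term with `σ` vanishes: `σ` kills `e` and `w`, and `w + e` is null. What remains is the
  -- square of the `e ∧ w` part.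
  simp [hσw, hσe, hew, hwe, hee, ← hq]
  field_simp
  ring

/-! ### Expansion of `ξ₊` in the orbit frame -/

/-- The coefficients of a smooth vector field in a smooth linearly independent family of vector
fields are smooth. -/
theorem contDiffAt_coeff {ι E F : Type*} [Fintype ι] [NormedAddCommGroup E]
    [NormedSpace ℝ E] [NormedAddCommGroup F] [NormedSpace ℝ F] [FiniteDimensional ℝ F]
    {v : ι → E → F} {X : E → F} {f : E → ι → ℝ} {x₀ : E} (hv : ∀ i, ContDiffAt ℝ ∞ (v i) x₀)
    (hX : ContDiffAt ℝ ∞ X x₀) (hli : LinearIndependent ℝ fun i => v i x₀)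
    (hf : ∀ᶠ x in nhds x₀, X x = ∑ i, f x i • v i x) : ContDiffAt ℝ ∞ f x₀ := by
  set T : E → (ι → ℝ) →L[ℝ] F := fun x =>
    ∑ i, (ContinuousLinearMap.proj (R := ℝ) (φ := fun _ : ι => ℝ) i).smulRight (v i x) with hT
  have hTapp : ∀ x c, T x c = ∑ i, c i • v i x := fun x c => by
    simp [hT]
  have hTsm : ContDiffAt ℝ ∞ T x₀ := by
    refine ContDiffAt.sum fun i _ => ?_
    exact (ContinuousLinearMap.smulRightL ℝ (ι → ℝ) F
      (ContinuousLinearMap.proj i)).contDiff.contDiffAt.comp x₀ (hv i)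
  have hker : LinearMap.ker (T x₀ : (ι → ℝ) →ₗ[ℝ] F) = ⊥ := by
    rw [LinearMap.ker_eq_bot']
    intro c hc
    have hc' : ∑ i, c i • v i x₀ = 0 := by rw [← hTapp]; exact hc
    funext i
    exact Fintype.linearIndependent_iff.1 hli c hc' i
  -- With a fixed left inverse `S` of `T x₀`, the map `S ∘ T x` stays invertible near `x₀`, so the
  -- coefficients are `(S ∘ T x)⁻¹ (S (X x))`, smooth because inversion is.
  obtain ⟨S, hS⟩ := LinearMap.exists_leftInverse_of_injective _ hker
  set S' : F →L[ℝ] (ι → ℝ) := LinearMap.toContinuousLinearMap S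
  set R : E → (ι → ℝ) →L[ℝ] (ι → ℝ) := fun x => S'.comp (T x) with hR
  have hR0 : R x₀ = ((ContinuousLinearEquiv.refl ℝ (ι → ℝ)) : (ι → ℝ) →L[ℝ] (ι → ℝ)) := by
    ext1 c
    exact LinearMap.congr_fun hS c
  have hRsm : ContDiffAt ℝ ∞ R x₀ := contDiffAt_const.clm_comp hTsm
  have hinv : ContDiffAt ℝ ∞ (fun x => ContinuousLinearMap.inverse (R x)) x₀ := by
    have h1 := contDiffAt_map_inverse (𝕜 := ℝ) (n := ∞) (ContinuousLinearEquiv.refl ℝ (ι → ℝ))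
    rw [← hR0] at h1
    exact h1.comp x₀ hRsm
  have hev : ∀ᶠ x in nhds x₀,
      R x ∈ Set.range ((↑) : ((ι → ℝ) ≃L[ℝ] (ι → ℝ)) → (ι → ℝ) →L[ℝ] (ι → ℝ)) :=
    hRsm.continuousAt.eventually_mem
      (ContinuousLinearEquiv.isOpen.mem_nhds ⟨ContinuousLinearEquiv.refl ℝ _, hR0.symm⟩)
  refine (hinv.clm_apply (contDiffAt_const (c := S') |>.clm_apply hX)).congr_of_eventuallyEq ?_
  filter_upwards [hev, hf] with x ⟨e, he⟩ hx
  have h2 : S' (X x) = R x (f x) := by simp [hR, hTapp, hx]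
  rw [h2, ← he, ContinuousLinearMap.inverse_equiv]
  simp

namespace NHEG

variable {d n N : ℕ} (G : NHEG d n N)

/-- The coefficients of `ξ₊` in the frame `ξ₋, ξ₀, m i` of the orbits. -/
structure OrbitCoeffs (a b : Pt d → ℝ) (c : Fin n → Pt d → ℝ) : Prop where
  smooth_a : ∀ x ∈ G.U, ContDiffAt ℝ ∞ a x
  smooth_b : ∀ x ∈ G.U, ContDiffAt ℝ ∞ b x
  smooth_c : ∀ i, ∀ x ∈ G.U, ContDiffAt ℝ ∞ (c i) x
  ξp_eq : ∀ x ∈ G.U, G.ξp x = a x • G.ξm x + b x • G.ξ0 x + ∑ i, c i x • G.m i x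

variable {G} {x : Pt d}

theorem contDiffAt_g (hx : x ∈ G.U) : ContDiffAt ℝ ∞ G.g x :=
  G.smooth_g.contDiffAt (G.isOpen_U.mem_nhds hx)

theorem contDiffAt_A (p : Fin N) (hx : x ∈ G.U) : ContDiffAt ℝ ∞ (G.A p) x :=
  (G.smooth_A p).contDiffAt (G.isOpen_U.mem_nhds hx)

theorem contDiffAt_ξm (hx : x ∈ G.U) : ContDiffAt ℝ ∞ G.ξm x :=
  G.smooth_ξm.contDiffAt (G.isOpen_U.mem_nhds hx)

theorem contDiffAt_ξ0 (hx : x ∈ G.U) : ContDiffAt ℝ ∞ G.ξ0 x :=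
  G.smooth_ξ0.contDiffAt (G.isOpen_U.mem_nhds hx)

theorem contDiffAt_ξp (hx : x ∈ G.U) : ContDiffAt ℝ ∞ G.ξp x :=
  G.smooth_ξp.contDiffAt (G.isOpen_U.mem_nhds hx)

theorem contDiffAt_m (i : Fin n) (hx : x ∈ G.U) : ContDiffAt ℝ ∞ (G.m i) x :=
  (G.smooth_m i).contDiffAt (G.isOpen_U.mem_nhds hx)

theorem frame_ext (hx : x ∈ G.U) {α β α' β' : ℝ} {γ γ' : Fin n → ℝ}
    (h : α • G.ξm x + β • G.ξ0 x + ∑ i, γ i • G.m i x =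
      α' • G.ξm x + β' • G.ξ0 x + ∑ i, γ' i • G.m i x) :
    α = α' ∧ β = β' ∧ ∀ i, γ i = γ' i := by
  have hli := Fintype.linearIndependent_iff.1 (G.linearIndependent x hx)
    (Sum.elim ![α - α', β - β'] fun i => γ i - γ' i) (by
      simp only [Fintype.sum_sum_type, Fin.sum_univ_two, Sum.elim_inl, Sum.elim_inr,
        Matrix.cons_val_zero, Matrix.cons_val_one, sub_smul, Finset.sum_sub_distrib]
      rw [← sub_eq_zero] at h
      rw [← h]
      abel)
  refine ⟨?_, ?_, fun i => ?_⟩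
  · simpa [sub_eq_zero] using hli (Sum.inl 0)
  · simpa [sub_eq_zero] using hli (Sum.inl 1)
  · simpa [sub_eq_zero] using hli (Sum.inr i)

theorem exists_frame_coeffs {v : Pt d}
    (hv : v ∈ Submodule.span ℝ (Set.range (Sum.elim ![G.ξm x, G.ξ0 x] (fun i => G.m i x)))) :
    ∃ f : Fin 2 ⊕ Fin n → ℝ, v = f (Sum.inl 0) • G.ξm x + f (Sum.inl 1) • G.ξ0 x +
      ∑ i, f (Sum.inr i) • G.m i x := by
  obtain ⟨f, hf⟩ := (Submodule.mem_span_range_iff_exists_fun ℝ).1 hv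
  refine ⟨f, ?_⟩
  rw [← hf]
  simp [Fintype.sum_sum_type, Fin.sum_univ_two]

-- Coefficients are chosen pointwise, with the dummy value `0` off `U`; linear independence
-- determines them on `U`, so smoothness follows from `contDiffAt_coeff`.
variable (G) in
theorem exists_orbitCoeffs : ∃ a b c, G.OrbitCoeffs a b c := by
  classical
  have h : ∀ x, ∃ f : Fin 2 ⊕ Fin n → ℝ, x ∈ G.U → G.ξp x = f (Sum.inl 0) • G.ξm x +
      f (Sum.inl 1) • G.ξ0 x + ∑ i, f (Sum.inr i) • G.m i x := by
    intro x
    by_cases hx : x ∈ G.U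
    · obtain ⟨f, hf⟩ := exists_frame_coeffs (G.ξp_mem_orbit x hx)
      exact ⟨f, fun _ => hf⟩
    · exact ⟨0, fun h => (hx h).elim⟩
  choose f hf using h
  have hsm : ∀ x ∈ G.U, ContDiffAt ℝ ∞ f x := by
    intro x hx
    refine contDiffAt_coeff (v := fun j y => Sum.elim ![G.ξm y, G.ξ0 y] (fun i => G.m i y) j)
      (X := G.ξp) ?_ (contDiffAt_ξp hx) ?_ ?_
    · rintro (j | i)
      · fin_cases j
        · exact contDiffAt_ξm hx
        · exact contDiffAt_ξ0 hx
      · exact contDiffAt_m i hx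
    · exact G.linearIndependent x hx
    · filter_upwards [G.isOpen_U.mem_nhds hx] with y hy
      rw [hf y hy]
      simp [Fintype.sum_sum_type, Fin.sum_univ_two]
  have hsm' : ∀ j, ∀ x ∈ G.U, ContDiffAt ℝ ∞ (fun y => f y j) x := fun j x hx =>
    contDiffAt_pi.1 (hsm x hx) j
  exact ⟨fun x => f x (Sum.inl 0), fun x => f x (Sum.inl 1), fun i x => f x (Sum.inr i),
    hsm' _, hsm' _, fun i => hsm' _, hf⟩

namespace OrbitCoeffs

variable {a b : Pt d → ℝ} {c : Fin n → Pt d → ℝ} (hO : G.OrbitCoeffs a b c)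
include hO

/-- The derivative of `ξ₊` in terms of the frame and its derivatives. -/
theorem fderiv_ξp (hx : x ∈ G.U) (v : Pt d) :
    fderiv ℝ G.ξp x v = (fderiv ℝ a x v • G.ξm x + fderiv ℝ b x v • G.ξ0 x +
      ∑ i, fderiv ℝ (c i) x v • G.m i x) + (a x • fderiv ℝ G.ξm x v + b x • fderiv ℝ G.ξ0 x v +
      ∑ i, c i x • fderiv ℝ (G.m i) x v) := by
  have hev : G.ξp =ᶠ[nhds x] fun y => a y • G.ξm y + b y • G.ξ0 y + ∑ i, c i y • G.m i y := by
    filter_upwards [G.isOpen_U.mem_nhds hx] with y hy using hO.ξp_eq y hy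
  have da := ((hO.smooth_a x hx).differentiableAt (by simp)).hasFDerivAt
  have db := ((hO.smooth_b x hx).differentiableAt (by simp)).hasFDerivAt
  have dc := fun i => ((hO.smooth_c i x hx).differentiableAt (by simp)).hasFDerivAt
  have dm := ((contDiffAt_ξm hx).differentiableAt (by simp)).hasFDerivAt
  have d0 := ((contDiffAt_ξ0 hx).differentiableAt (by simp)).hasFDerivAt
  have di := fun i => ((contDiffAt_m i hx).differentiableAt (by simp)).hasFDerivAt
  rw [hev.fderiv_eq, (((da.fun_smul dm).fun_add (db.fun_smul d0)).fun_add
    (HasFDerivAt.fun_sum fun i (_ : i ∈ Finset.univ) => (dc i).fun_smul (di i))).fderiv]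
  simp only [add_apply, sum_apply, smul_apply,
    ContinuousLinearMap.smulRight_apply, Finset.sum_add_distrib]
  abel

/-- The bracket of `ξ₊` with a field, in terms of the frame. -/
theorem lieBracket_ξp (hx : x ∈ G.U) (X : VField d) :
    VectorField.lieBracket ℝ X G.ξp x = (fderiv ℝ a x (X x) • G.ξm x +
      fderiv ℝ b x (X x) • G.ξ0 x + ∑ i, fderiv ℝ (c i) x (X x) • G.m i x) +
      (a x • VectorField.lieBracket ℝ X G.ξm x + b x • VectorField.lieBracket ℝ X G.ξ0 x +
      ∑ i, c i x • VectorField.lieBracket ℝ X (G.m i) x) := by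
  simp only [VectorField.lieBracket, hO.fderiv_ξp hx, hO.ξp_eq x hx, map_add, map_sum, map_smul,
    smul_sub, Finset.sum_sub_distrib]
  abel

/-- Comparison of frame coefficients in `[ξ₋, ξ₊] = ξ₀`; the term `-b` comes from `[ξ₋, ξ₀] = ξ₋`.
The next two lemmas treat `[ξ₀, ξ₊] = ξ₊` and `[m_j, ξ₊] = 0` likewise. -/
theorem along_ξm (hx : x ∈ G.U) : fderiv ℝ a x (G.ξm x) = -b x ∧ fderiv ℝ b x (G.ξm x) = 1 ∧
    ∀ i, fderiv ℝ (c i) x (G.ξm x) = 0 := by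
  have h := hO.lieBracket_ξp hx G.ξm
  have h0 : VectorField.lieBracket ℝ G.ξm G.ξ0 x = G.ξm x := by
    rw [VectorField.lieBracket_swap]; simp [G.bracket_0m x hx]
  rw [G.bracket_mp x hx, h0] at h
  simp only [VectorField.lieBracket_self, G.bracket_ξm_m _ x hx] at h
  have := frame_ext hx (α := fderiv ℝ a x (G.ξm x) + b x) (α' := 0) (β' := 1) (γ' := fun _ => 0)
    (γ := fun i => fderiv ℝ (c i) x (G.ξm x)) (β := fderiv ℝ b x (G.ξm x)) (by
      simp only [Pi.zero_apply, smul_zero, Finset.sum_const_zero] at h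
      simp only [zero_smul, Finset.sum_const_zero, one_smul]
      rw [add_smul, zero_add, add_zero]
      conv_rhs => rw [h]
      abel)
  exact ⟨by linarith [this.1], this.2.1, this.2.2⟩

theorem along_ξ0 (hx : x ∈ G.U) : fderiv ℝ a x (G.ξ0 x) = 2 * a x ∧
    fderiv ℝ b x (G.ξ0 x) = b x ∧ ∀ i, fderiv ℝ (c i) x (G.ξ0 x) = c i x := by
  have h := hO.lieBracket_ξp hx G.ξ0
  rw [G.bracket_0p x hx, G.bracket_0m x hx, hO.ξp_eq x hx] at h
  simp only [VectorField.lieBracket_self, G.bracket_ξ0_m _ x hx] at h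
  have := frame_ext hx (α := fderiv ℝ a x (G.ξ0 x) - a x) (α' := a x) (β' := b x)
    (γ' := fun i => c i x)
    (γ := fun i => fderiv ℝ (c i) x (G.ξ0 x)) (β := fderiv ℝ b x (G.ξ0 x)) (by
      simp only [Pi.zero_apply, smul_zero, Finset.sum_const_zero, smul_neg] at h
      rw [h, sub_smul]
      abel)
  exact ⟨by linarith [this.1], this.2.1, this.2.2⟩

theorem along_m (hx : x ∈ G.U) (j : Fin n) : fderiv ℝ a x (G.m j x) = 0 ∧
    fderiv ℝ b x (G.m j x) = 0 ∧ ∀ i, fderiv ℝ (c i) x (G.m j x) = 0 := by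
  have h := hO.lieBracket_ξp hx (G.m j)
  have hs : ∀ X : VField d, VectorField.lieBracket ℝ X (G.m j) x = 0 →
      VectorField.lieBracket ℝ (G.m j) X x = 0 := fun X hX => by
    rw [VectorField.lieBracket_swap]; simp [hX]
  rw [hs _ (G.bracket_ξp_m j x hx), hs _ (G.bracket_ξm_m j x hx),
    hs _ (G.bracket_ξ0_m j x hx)] at h
  simp only [G.bracket_m_m _ _ x hx] at h
  exact frame_ext hx (α' := 0) (β' := 0) (γ' := fun _ => 0) (by
      simp only [smul_zero, Finset.sum_const_zero, add_zero] at h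
      simp only [zero_smul, Finset.sum_const_zero, add_zero]
      exact h.symm)

/-- The Killing equation of `ξ₊`, expressed through the differentials of its coefficients. -/
theorem killing_coeffs (hx : x ∈ G.U) (v w : Pt d) :
    (fderiv ℝ a x v * G.g x (G.ξm x) w + fderiv ℝ b x v * G.g x (G.ξ0 x) w +
      ∑ i, fderiv ℝ (c i) x v * G.g x (G.m i x) w) +
    (fderiv ℝ a x w * G.g x (G.ξm x) v + fderiv ℝ b x w * G.g x (G.ξ0 x) v +
      ∑ i, fderiv ℝ (c i) x w * G.g x (G.m i x) v) = 0 := by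
  have hs := (G.lorentzian x hx).1
  have h := G.killing_ξp x hx v w
  have hm := G.killing_ξm x hx v w
  have h0 := G.killing_ξ0 x hx v w
  have hi : ∑ i, c i x * lieTwo (G.m i) G.g x v w = 0 :=
    Finset.sum_eq_zero fun i _ => by rw [G.killing_m i x hx v w, mul_zero]
  simp only [lieTwo, mul_add, Finset.sum_add_distrib] at h hm h0 hi
  simp only [hO.ξp_eq x hx, hO.fderiv_ξp hx, map_add, map_sum, map_smul, add_apply,
    sum_apply, smul_apply, smul_eq_mul] at h
  rw [hs v (G.ξm x), hs v (G.ξ0 x)] at h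
  simp_rw [hs v (G.m _ x)] at h
  -- Subtracting the frame's Killing equations with weights `a, b, c` removes every derivative of
  -- the metric and of the frame.
  linear_combination h - a x * hm - b x * h0 - hi

end OrbitCoeffs
end NHEG

/-! ### Geometry of the orbits and their normal directions -/

namespace NHEG

variable {d n N : ℕ} {G : NHEG d n N} {x : Pt d}

variable (G) in
/-- The vector `b ξ₋ - ξ₀`, orthogonal to `ξ₋` and all `m i`. -/
def radial (b : Pt d → ℝ) (x : Pt d) : Pt d := b x • G.ξm x - G.ξ0 x

variable (G) in
/-- The vector `(2a + b²) ξ₋ + c^i m_i`, orthogonal to all `m i` and to `radial`. -/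
def temporal (a b : Pt d → ℝ) (c : Fin n → Pt d → ℝ) (x : Pt d) : Pt d :=
  (2 * a x + b x ^ 2) • G.ξm x + ∑ i, c i x • G.m i x

variable (G) in
/-- Orthogonality of a vector to the orbit through `x`. -/
structure IsPerp (x y : Pt d) : Prop where
  ξm : G.g x (G.ξm x) y = 0
  ξ0 : G.g x (G.ξ0 x) y = 0
  m : ∀ i, G.g x (G.m i x) y = 0

theorem sum_m_eq_zero (hx : x ∈ G.U) {γ : Fin n → ℝ}
    (h : G.g x (∑ i, γ i • G.m i x) (∑ i, γ i • G.m i x) ≤ 0) : γ = 0 := by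
  by_contra hne
  exact absurd (G.m_spacelike x hx γ hne) (not_lt.2 h)

theorem sum_m_nonneg (hx : x ∈ G.U) (γ : Fin n → ℝ) :
    0 ≤ G.g x (∑ i, γ i • G.m i x) (∑ i, γ i • G.m i x) := by
  by_cases h : γ = 0
  · simp [h]
  · exact (G.m_spacelike x hx γ h).le

theorem exists_orbit_timelike (hx : x ∈ G.U) : ∃ (α β : ℝ) (γ : Fin n → ℝ),
    G.g x (α • G.ξm x + β • G.ξ0 x + ∑ i, γ i • G.m i x)
      (α • G.ξm x + β • G.ξ0 x + ∑ i, γ i • G.m i x) < 0 := by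
  obtain ⟨v, hv, hneg⟩ := G.orbit_timelike x hx
  obtain ⟨f, rfl⟩ := exists_frame_coeffs hv
  exact ⟨_, _, _, hneg⟩

/-- A vector of an orbit that is orthogonal to the orbit vanishes. -/
theorem orbit_eq_zero_of_isPerp (hx : x ∈ G.U) {u : Pt d} (hu : G.IsPerp x u)
    (huu : G.g x u u ≤ 0) : u = 0 := by
  obtain ⟨α, β, γ, hneg⟩ := exists_orbit_timelike hx
  by_contra hne
  refine absurd ((G.lorentzian x hx).pos_of_orthogonal hneg ?_ hne) (not_lt.2 huu)
  simp [hu.ξm, hu.ξ0, hu.m]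

theorem radial_ne_zero {b : Pt d → ℝ} (hx : x ∈ G.U) : G.radial b x ≠ 0 := by
  intro h
  have := frame_ext hx (α := b x) (β := -1) (γ := fun _ => 0) (α' := 0) (β' := 0)
    (γ' := fun _ => 0) (by simp; rw [← sub_eq_add_neg]; exact h)
  linarith [this.2.1]

namespace OrbitCoeffs

variable {a b : Pt d → ℝ} {c : Fin n → Pt d → ℝ} (hO : G.OrbitCoeffs a b c)
include hO

/-- The `(ξ₋, ξ₋)` component of `killing_coeffs`. The components `(ξ₋, m)`, `(ξ₀, m)` and `(ξ₀, ξ₋)`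
give the further orthogonality relations below. -/
theorem g_ξm_ξ0 (hx : x ∈ G.U) : G.g x (G.ξm x) (G.ξ0 x) = b x * G.g x (G.ξm x) (G.ξm x) := by
  have h := hO.killing_coeffs hx (G.ξm x) (G.ξm x)
  obtain ⟨h1, h2, h3⟩ := hO.along_ξm hx
  simp only [h1, h2, h3, zero_mul, Finset.sum_const_zero] at h
  rw [(G.lorentzian x hx).1 (G.ξ0 x)] at h
  linarith

theorem g_radial_ξm (hx : x ∈ G.U) : G.g x (G.radial b x) (G.ξm x) = 0 := by
  have h := hO.g_ξm_ξ0 hx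
  rw [(G.lorentzian x hx).1] at h
  simp [radial, h]

theorem g_radial_m (hx : x ∈ G.U) (j : Fin n) : G.g x (G.radial b x) (G.m j x) = 0 := by
  have h := hO.killing_coeffs hx (G.ξm x) (G.m j x)
  obtain ⟨h1, h2, h3⟩ := hO.along_ξm hx
  obtain ⟨h1', h2', h3'⟩ := hO.along_m hx j
  simp only [h1, h2, h3, h1', h2', h3', zero_mul, Finset.sum_const_zero] at h
  simp [radial]
  linarith

theorem g_temporal_m (hx : x ∈ G.U) (j : Fin n) :
    G.g x (G.temporal a b c x) (G.m j x) = 0 := by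
  have h := hO.killing_coeffs hx (G.ξ0 x) (G.m j x)
  obtain ⟨h1, h2, h3⟩ := hO.along_ξ0 hx
  obtain ⟨h1', h2', h3'⟩ := hO.along_m hx j
  simp only [h1, h2, h3, h1', h2', h3', zero_mul, Finset.sum_const_zero] at h
  have hr := hO.g_radial_m hx j
  simp [radial] at hr
  simp [temporal]
  linear_combination h + b x * hr

theorem g_temporal_ξm (hx : x ∈ G.U) :
    G.g x (G.temporal a b c x) (G.ξm x) = -G.g x (G.radial b x) (G.radial b x) := by
  have h := hO.killing_coeffs hx (G.ξ0 x) (G.ξm x)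
  obtain ⟨h1, h2, h3⟩ := hO.along_ξ0 hx
  obtain ⟨h1', h2', h3'⟩ := hO.along_ξm hx
  simp only [h1, h2, h3, h1', h2', h3', zero_mul, Finset.sum_const_zero] at h
  have hr := hO.g_ξm_ξ0 hx
  have hs := (G.lorentzian x hx).1 (G.ξm x) (G.ξ0 x)
  simp [temporal, radial]
  linear_combination h - 2 * b x * hr + 2 * b x * hs

theorem g_radial_temporal (hx : x ∈ G.U) :
    G.g x (G.radial b x) (G.temporal a b c x) = 0 := by
  simp [temporal, hO.g_radial_ξm hx, hO.g_radial_m hx]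

theorem g_temporal_temporal (hx : x ∈ G.U) :
    G.g x (G.temporal a b c x) (G.temporal a b c x) =
      -((2 * a x + b x ^ 2) * G.g x (G.radial b x) (G.radial b x)) := by
  conv_lhs => arg 2; rw [temporal]
  simp [hO.g_temporal_ξm hx, hO.g_temporal_m hx]

/-- The squared norm of an orbit vector, diagonalised. -/
theorem g_orbit_self (hx : x ∈ G.U) (α β : ℝ) (γ : Fin n → ℝ) :
    (2 * a x + b x ^ 2) ^ 2 * G.g x (α • G.ξm x + β • G.ξ0 x + ∑ i, γ i • G.m i x)
      (α • G.ξm x + β • G.ξ0 x + ∑ i, γ i • G.m i x) =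
    ((2 * a x + b x ^ 2) * β ^ 2 - (α + β * b x) ^ 2) * (2 * a x + b x ^ 2) *
        G.g x (G.radial b x) (G.radial b x) +
      G.g x (∑ i, ((2 * a x + b x ^ 2) * γ i - (α + β * b x) * c i x) • G.m i x)
        (∑ i, ((2 * a x + b x ^ 2) * γ i - (α + β * b x) * c i x) • G.m i x) := by
  set D := 2 * a x + b x ^ 2 with hD
  set v := α • G.ξm x + β • G.ξ0 x + ∑ i, γ i • G.m i x with hv
  set μ := ∑ i, (D * γ i - (α + β * b x) * c i x) • G.m i x with hμ
  have hs := (G.lorentzian x hx).1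
  -- Scaling by `D` avoids dividing by it: this identity is used below to prove that `D` is
  -- positive.
  have hdec : D • v = (α + β * b x) • G.temporal a b c x - (D * β) • G.radial b x + μ := by
    have h0 : G.ξ0 x = b x • G.ξm x - G.radial b x := by simp [radial]
    have ht : D • G.ξm x = G.temporal a b c x - ∑ i, c i x • G.m i x := by simp [temporal, hD]
    have hμ' : μ = D • ∑ i, γ i • G.m i x - (α + β * b x) • ∑ i, c i x • G.m i x := by
      simp only [hμ, sub_smul, Finset.sum_sub_distrib, Finset.smul_sum, smul_smul]
    calc D • v = (α + β * b x) • (D • G.ξm x) - (D * β) • G.radial b x +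
          D • ∑ i, γ i • G.m i x := by rw [hv, h0]; module
      _ = _ := by rw [ht, hμ']; module
  have h1 : G.g x (G.temporal a b c x) μ = 0 := by simp [hμ, hO.g_temporal_m hx]
  have h2 : G.g x (G.radial b x) μ = 0 := by simp [hμ, hO.g_radial_m hx]
  have h3 : D ^ 2 * G.g x v v = G.g x (D • v) (D • v) := by simp; ring
  rw [h3, hdec]
  have h4 := hO.g_radial_temporal hx
  have h5 := hO.g_temporal_temporal hx
  have h6 := hs (G.temporal a b c x) (G.radial b x)
  have h7 := hs μ (G.radial b x)
  have h8 := hs μ (G.temporal a b c x)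
  rw [h1] at h8; rw [h2] at h7; rw [h4] at h6
  simp only [map_add, map_sub, map_smul, add_apply, sub_apply, smul_apply, smul_eq_mul, h1, h2,
    h4, h5, h6, h7, h8, ← hD]
  ring

/-- If `2a + b² = 0`, then `temporal` is a null combination of the spacelike `m_i`, hence zero. By
`g_temporal_ξm`, `radial` is then null and orthogonal to the whole orbit; since the orbit contains a
timelike vector, `radial` would vanish. -/
theorem discr_ne_zero (hx : x ∈ G.U) : 2 * a x + b x ^ 2 ≠ 0 := by
  intro hD
  have hs := (G.lorentzian x hx).1
  have htt := hO.g_temporal_temporal hx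
  rw [hD, zero_mul, neg_zero] at htt
  have hc : (fun i => c i x) = 0 := by
    apply sum_m_eq_zero hx
    simp only [temporal, hD, zero_smul, zero_add] at htt
    exact htt.le
  have ht : G.temporal a b c x = 0 := by
    have : ∀ i, c i x = 0 := fun i => congrFun hc i
    simp [temporal, hD, this]
  have hw := hO.g_temporal_ξm hx
  rw [ht] at hw
  simp at hw
  refine radial_ne_zero hx (orbit_eq_zero_of_isPerp hx ⟨?_, ?_, fun i => ?_⟩ hw.le)
  · rw [hs, hO.g_radial_ξm hx]
  · have h0 : G.ξ0 x = b x • G.ξm x - G.radial b x := by simp [radial]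
    rw [hs, h0]; simp [hO.g_radial_ξm hx, hw]
  · rw [hs, hO.g_radial_m hx]

/-- For a negative value there are two cases. If `radial` is timelike, so is `temporal`, and they
are orthogonal, which a Lorentzian form forbids. Otherwise `g_orbit_self` makes the metric
nonnegative on the orbit, which contains a timelike vector. -/
theorem discr_pos (hx : x ∈ G.U) : 0 < 2 * a x + b x ^ 2 := by
  by_contra hle
  have hneg : 2 * a x + b x ^ 2 < 0 := lt_of_le_of_ne (not_lt.1 hle) (hO.discr_ne_zero hx)
  set D := 2 * a x + b x ^ 2 with hD
  rcases lt_or_ge (G.g x (G.radial b x) (G.radial b x)) 0 with hw | hw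
  · have ht : G.temporal a b c x ≠ 0 := by
      intro h
      have := frame_ext hx (α := D) (β := 0) (γ := fun i => c i x) (α' := 0) (β' := 0)
        (γ' := fun _ => 0) (by simpa [temporal] using h)
      exact hneg.ne this.1
    have := (G.lorentzian x hx).pos_of_orthogonal hw (hO.g_radial_temporal hx) ht
    rw [hO.g_temporal_temporal hx, ← hD] at this
    nlinarith
  · obtain ⟨α, β, γ, hv⟩ := exists_orbit_timelike hx
    have h1 := hO.g_orbit_self hx α β γ
    rw [← hD] at h1
    have h2 := sum_m_nonneg hx fun i => D * γ i - (α + β * b x) * c i x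
    have h3 : 0 ≤ (D * β ^ 2 - (α + β * b x) ^ 2) * D :=
      mul_nonneg_of_nonpos_of_nonpos (by nlinarith [sq_nonneg β, sq_nonneg (α + β * b x)])
        hneg.le
    have h4 := mul_nonneg h3 hw
    have h5 := mul_neg_of_pos_of_neg (pow_pos (neg_pos.2 hneg) 2) hv
    rw [neg_sq] at h5
    linarith

theorem g_radial_ne_zero (hx : x ∈ G.U) : G.g x (G.radial b x) (G.radial b x) ≠ 0 := by
  intro h
  obtain ⟨α, β, γ, hv⟩ := exists_orbit_timelike hx
  have h1 := hO.g_orbit_self hx α β γ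
  have h2 := sum_m_nonneg hx fun i => (2 * a x + b x ^ 2) * γ i - (α + β * b x) * c i x
  rw [h, mul_zero, zero_add] at h1
  have h5 := mul_neg_of_pos_of_neg (pow_pos (hO.discr_pos hx) 2) hv
  linarith

/-- The differentials of the coefficients vanish orthogonally to the orbits. -/
theorem fderiv_isPerp (hx : x ∈ G.U) {y : Pt d} (hy : G.IsPerp x y) :
    fderiv ℝ a x y = 0 ∧ fderiv ℝ b x y = 0 ∧ ∀ i, fderiv ℝ (c i) x y = 0 := by
  -- For normal `y` the second bracket of `killing_coeffs` drops out and the first says that `u` is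
  -- orthogonal to every vector; so `u = 0`.
  set u := fderiv ℝ a x y • G.ξm x + fderiv ℝ b x y • G.ξ0 x +
    ∑ i, fderiv ℝ (c i) x y • G.m i x with hu
  have hs := (G.lorentzian x hx).1
  have key : ∀ w, G.g x u w + (fderiv ℝ a x w * G.g x (G.ξm x) y +
      fderiv ℝ b x w * G.g x (G.ξ0 x) y + ∑ i, fderiv ℝ (c i) x w * G.g x (G.m i x) y) = 0 := by
    intro w
    have h := hO.killing_coeffs hx y w
    simpa [hu] using h
  simp only [hy.ξm, hy.ξ0, hy.m, mul_zero, Finset.sum_const_zero, add_zero] at key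
  have hu0 : u = 0 := orbit_eq_zero_of_isPerp hx
    ⟨by rw [hs, key], by rw [hs, key], fun i => by rw [hs, key]⟩ (key u).le
  exact frame_ext hx (α' := 0) (β' := 0) (γ' := fun _ => 0) (by rw [← hu, hu0]; simp)

end OrbitCoeffs

theorem det_gPhiPhi (hx : x ∈ G.U) : IsUnit (G.gPhiPhi x).det := by
  rw [isUnit_iff_ne_zero]
  intro h0
  obtain ⟨γ, hγ, hM⟩ := Matrix.exists_mulVec_eq_zero_iff.2 h0
  refine hγ (sum_m_eq_zero hx (le_of_eq ?_))
  have h1 : ∀ i, G.g x (G.m i x) (∑ j, γ j • G.m j x) = 0 := fun i => by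
    have := congrFun hM i
    simp only [Matrix.mulVec, dotProduct, gPhiPhi, Matrix.of_apply, Pi.zero_apply] at this
    rw [← this]
    simp [mul_comm]
  rw [map_sum]
  exact Finset.sum_eq_zero fun i _ => by
    rw [map_smul, (G.lorentzian x hx).1, h1, smul_zero]

/-- Orthogonal projection to the span of the `m i`. -/
theorem exists_sub_m_perp (hx : x ∈ G.U) (v : Pt d) : ∃ γ : Fin n → ℝ,
    ∀ j, G.g x (G.m j x) (v - ∑ i, γ i • G.m i x) = 0 := by
  refine ⟨(G.gPhiPhi x)⁻¹.mulVec fun j => G.g x (G.m j x) v, fun j => ?_⟩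
  set γ := (G.gPhiPhi x)⁻¹.mulVec fun j => G.g x (G.m j x) v with hγ
  have h1 : (G.gPhiPhi x).mulVec γ = fun j => G.g x (G.m j x) v := by
    rw [hγ, Matrix.mulVec_mulVec, Matrix.mul_nonsing_inv _ (det_gPhiPhi hx), Matrix.one_mulVec]
  have h2 := congrFun h1 j
  simp only [Matrix.mulVec, dotProduct, gPhiPhi, Matrix.of_apply] at h2
  rw [map_sub, ← h2]
  simp [mul_comm]

namespace OrbitCoeffs

variable {a b : Pt d → ℝ} {c : Fin n → Pt d → ℝ} (hO : G.OrbitCoeffs a b c)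
include hO

/-- A vector orthogonal to `radial`, `temporal` and all `m i` is orthogonal to the orbit. -/
theorem isPerp_of_orthogonal (hx : x ∈ G.U) {y : Pt d} (hr : G.g x (G.radial b x) y = 0)
    (ht : G.g x (G.temporal a b c x) y = 0) (hm : ∀ i, G.g x (G.m i x) y = 0) :
    G.IsPerp x y := by
  have h1 : G.g x (G.ξm x) y = 0 := by
    simp [temporal, hm] at ht
    exact ht.resolve_left (hO.discr_ne_zero hx)
  refine ⟨h1, ?_, hm⟩
  simp [radial, h1] at hr
  exact hr

/-- `radial` and `temporal` are non-null and orthogonal to each other and to the `m_i`, so the three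
projections can be subtracted successively; the remainder is normal. -/
theorem exists_decomp (hx : x ∈ G.U) (v : Pt d) : ∃ (α β : ℝ) (γ : Fin n → ℝ) (y : Pt d),
    G.IsPerp x y ∧ v = α • G.ξm x + β • G.ξ0 x + ∑ i, γ i • G.m i x + y := by
  obtain ⟨γ, hγ⟩ := exists_sub_m_perp hx v
  have hs := (G.lorentzian x hx).1
  set D := 2 * a x + b x ^ 2 with hD
  set w := G.radial b x with hw
  set s := G.temporal a b c x with hs'
  have hww : G.g x w w ≠ 0 := hO.g_radial_ne_zero hx
  have hss : G.g x s s ≠ 0 := by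
    rw [hs', hO.g_temporal_temporal hx]
    exact neg_ne_zero.2 (mul_ne_zero (hO.discr_ne_zero hx) hww)
  have hws : G.g x w s = 0 := hO.g_radial_temporal hx
  have hsw : G.g x s w = 0 := by rw [hs, hws]
  have hwm : ∀ i, G.g x w (G.m i x) = 0 := hO.g_radial_m hx
  have hsm : ∀ i, G.g x s (G.m i x) = 0 := hO.g_temporal_m hx
  have hmw : ∀ i, G.g x (G.m i x) w = 0 := fun i => by rw [hs, hwm]
  have hms : ∀ i, G.g x (G.m i x) s = 0 := fun i => by rw [hs, hsm]
  set p := G.g x w v / G.g x w w with hp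
  set q := G.g x s v / G.g x s s with hq
  refine ⟨p * b x + q * D, -p, fun i => γ i + q * c i x,
    v - (∑ i, γ i • G.m i x) - p • w - q • s, ?_, ?_⟩
  · refine hO.isPerp_of_orthogonal hx ?_ ?_ fun i => ?_
    · simp [← hw, hws, hwm, hp, hww]
    · simp [← hs', hsw, hsm, hq, hss]
    · rw [map_sub, map_sub, hγ]
      simp [hmw, hms]
  · have hsum : ∑ i, (γ i + q * c i x) • G.m i x =
        ∑ i, γ i • G.m i x + q • ∑ i, c i x • G.m i x := by
      simp only [add_smul, Finset.sum_add_distrib, Finset.smul_sum, smul_smul]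
    rw [hsum, hw, hs']
    simp only [radial, temporal, ← hD]
    module

/-- The test for constancy: a differential is checked only on `ξ₋`, `ξ₀`, the `m_i` and normal
vectors. -/
theorem clm_eq_zero (hx : x ∈ G.U) {E : Type*} [NormedAddCommGroup E] [NormedSpace ℝ E]
    {T : Pt d →L[ℝ] E} (hm : T (G.ξm x) = 0) (h0 : T (G.ξ0 x) = 0)
    (hi : ∀ i, T (G.m i x) = 0) (hy : ∀ y, G.IsPerp x y → T y = 0) : T = 0 := by
  ext1 v
  obtain ⟨α, β, γ, y, hperp, rfl⟩ := hO.exists_decomp hx v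
  simp [hm, h0, hi, hy y hperp]

end OrbitCoeffs
end NHEG

/-! ### Poincaré coordinates and constancy of `k` -/

namespace NHEG

variable {d n N : ℕ} {G : NHEG d n N} {x : Pt d}

theorem is_const_on_U {E : Type*} [NormedAddCommGroup E] [NormedSpace ℝ E]
    {f : Pt d → E} (hf : ∀ x ∈ G.U, DifferentiableAt ℝ f x)
    (h : ∀ x ∈ G.U, fderiv ℝ f x = 0) : ∃ k, ∀ x ∈ G.U, f x = k :=
  G.isOpen_U.exists_is_const_of_fderiv_eq_zero G.isConnected_U.isPreconnected
    (fun x hx => (hf x hx).differentiableWithinAt) (fun x hx => h x hx)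

/-- Poincaré coordinates are built from the coefficients of `ξ₊`. -/
theorem OrbitCoeffs.isPoincare {a b : Pt d → ℝ} {c : Fin n → Pt d → ℝ}
    (hO : G.OrbitCoeffs a b c) :
    G.IsPoincare b fun x => (√(2 * a x + b x ^ 2))⁻¹ := by
  -- The formula for `r` is the positive solution of `2a + b² = 1/r²`, the value forced by the
  -- prescribed action of `ξ₊`.
  have hpos := fun x hx => hO.discr_pos (x := x) hx
  have hsq : ∀ x ∈ G.U, √(2 * a x + b x ^ 2) ≠ 0 := fun x hx => (Real.sqrt_pos.2 (hpos x hx)).ne'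
  have hD : ∀ x ∈ G.U, ContDiffAt ℝ ∞ (fun x => 2 * a x + b x ^ 2) x := fun x hx =>
    (contDiffAt_const.mul (hO.smooth_a x hx)).add ((hO.smooth_b x hx).pow 2)
  have hr : ∀ x ∈ G.U, ∀ v, fderiv ℝ (fun x => (√(2 * a x + b x ^ 2))⁻¹) x v =
      -((√(2 * a x + b x ^ 2))⁻¹ * (2 * a x + b x ^ 2)⁻¹ *
        (fderiv ℝ a x v + b x * fderiv ℝ b x v)) := by
    intro x hx v
    have da := ((hO.smooth_a x hx).differentiableAt (by simp)).hasFDerivAt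
    have db := ((hO.smooth_b x hx).differentiableAt (by simp)).hasFDerivAt
    have h : HasFDerivAt (fun x => (√(2 * a x + b x ^ 2))⁻¹) _ x :=
      (hasDerivAt_inv (hsq x hx)).comp_hasFDerivAt x
        (((da.const_mul 2).fun_add (db.pow 2)).sqrt (hpos x hx).ne')
    rw [h.fderiv]
    simp
    rw [Real.sq_sqrt (hpos x hx).le]
    field_simp
    ring
  obtain hm := fun x hx => hO.along_ξm (x := x) hx
  obtain h0 := fun x hx => hO.along_ξ0 (x := x) hx
  obtain hi := fun x hx => hO.along_m (x := x) hx
  have hp : ∀ x ∈ G.U, ∀ T : Pt d →L[ℝ] ℝ, (∀ i, T (G.m i x) = 0) →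
      T (G.ξp x) = a x * T (G.ξm x) + b x * T (G.ξ0 x) := fun x hx T hT => by
    rw [hO.ξp_eq x hx]; simp [hT]
  refine ⟨fun x hx => (hO.smooth_b x hx).contDiffWithinAt, fun x hx =>
    (((hD x hx).sqrt (hpos x hx).ne').inv (hsq x hx)).contDiffWithinAt,
    fun x hx => inv_ne_zero (hsq x hx), fun x hx => (hm x hx).2.1, fun x hx => ?_,
    fun x hx => (h0 x hx).2.1, fun x hx => ?_, fun x hx => ?_, fun x hx => ?_,
    fun i x hx => (hi x hx i).2.1, fun i x hx => ?_⟩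
  · simp [along, hr x hx, (hm x hx).1, (hm x hx).2.1]
  · have := (hpos x hx).ne'
    simp only [along, hr x hx, (h0 x hx).1, (h0 x hx).2.1]
    rw [show 2 * a x + b x * b x = 2 * a x + b x ^ 2 by ring]
    field_simp
  · rw [along, hp x hx _ fun i => (hi x hx i).2.1, (hm x hx).2.1, (h0 x hx).2.1]
    rw [inv_pow, Real.sq_sqrt (hpos x hx).le]
    simp
    ring
  · rw [along, hp x hx]
    · have := (hpos x hx).ne'
      simp only [hr x hx, (h0 x hx).1, (h0 x hx).2.1, (hm x hx).1, (hm x hx).2.1]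
      linear_combination -(b x * (√(2 * a x + b x ^ 2))⁻¹) * inv_mul_cancel₀ this
    · intro i; simp [hr x hx, (hi x hx i).1, (hi x hx i).2.1]
  · simp [along, hr x hx, (hi x hx i).1, (hi x hx i).2.1]

/-- In Poincaré coordinates the coefficients of `ξ₊` are the standard ones. -/
theorem OrbitCoeffs.eq_of_isPoincare {a b t r : Pt d → ℝ} {c : Fin n → Pt d → ℝ}
    (hO : G.OrbitCoeffs a b c) (hP : G.IsPoincare t r) (hx : x ∈ G.U) :
    b x = t x ∧ 2 * a x = 1 / r x ^ 2 - t x ^ 2 := by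
  have hr := hP.r_ne x hx
  have hp : ∀ T : Pt d →L[ℝ] ℝ, (∀ i, T (G.m i x) = 0) →
      T (G.ξp x) = a x * T (G.ξm x) + b x * T (G.ξ0 x) := fun T hT => by
    rw [hO.ξp_eq x hx]; simp [hT]
  -- Applying `dr` to the expansion of `ξ₊` gives `-t r = -b r`; applying `dt` then determines `a`.
  have h1 := hp _ fun i => hP.m_r i x hx
  have h2 := hp _ fun i => hP.m_t i x hx
  have e1 := hP.ξp_r x hx
  have e2 := hP.ξp_t x hx
  have e3 := hP.ξm_r x hx
  have e4 := hP.ξm_t x hx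
  have e5 := hP.ξ0_r x hx
  have e6 := hP.ξ0_t x hx
  simp only [along] at e1 e2 e3 e4 e5 e6
  rw [e1, e3, e5] at h1
  rw [e2, e4, e6] at h2
  have hb : b x = t x := by
    apply mul_right_cancel₀ hr
    linarith
  refine ⟨hb, ?_⟩
  rw [hb] at h2
  linarith

/-- Differentiate `(2a + b²) r² = 1`, using that `da` and `db` vanish on normal vectors. -/
theorem OrbitCoeffs.fderiv_r_isPerp {a b t r : Pt d → ℝ} {c : Fin n → Pt d → ℝ}
    (hO : G.OrbitCoeffs a b c) (hP : G.IsPoincare t r) (hx : x ∈ G.U) {y : Pt d}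
    (hy : G.IsPerp x y) : fderiv ℝ r x y = 0 := by
  obtain ⟨ha, hb, -⟩ := hO.fderiv_isPerp hx hy
  have hev : (fun y => (2 * a y + b y ^ 2) * r y ^ 2) =ᶠ[nhds x] fun _ => 1 := by
    filter_upwards [G.isOpen_U.mem_nhds hx] with y hy
    obtain ⟨h1, h2⟩ := hO.eq_of_isPoincare hP hy
    have := hP.r_ne y hy
    rw [h2, h1]
    field_simp
    ring
  have da := ((hO.smooth_a x hx).differentiableAt (by simp)).hasFDerivAt
  have db := ((hO.smooth_b x hx).differentiableAt (by simp)).hasFDerivAt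
  have dr := ((hP.smooth_r.contDiffAt (G.isOpen_U.mem_nhds hx)).differentiableAt
    (by simp)).hasFDerivAt
  have h := (((da.const_mul 2).fun_add (db.pow 2)).fun_mul (dr.pow 2)).fderiv
  rw [hev.fderiv_eq] at h
  have h1 := congrArg (fun T : Pt d →L[ℝ] ℝ => T y) h
  simp [ha, hb, hP.r_ne x hx] at h1
  exact h1.resolve_left (hO.discr_ne_zero hx)

/-- The data carried by Poincaré coordinates, in terms of the constants `k`: the expansion of
`ξ₊` has coefficients `(1/r² - t²)/2`, `t`, `-k/r`. -/
theorem exists_k {t r : Pt d → ℝ} (hP : G.IsPoincare t r) : ∃ k : Fin n → ℝ,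
    G.OrbitCoeffs (fun x => (1 / r x ^ 2 - t x ^ 2) / 2) t (fun i x => -k i / r x) := by
  obtain ⟨a, b, c, hO⟩ := G.exists_orbitCoeffs
  have hrs : ∀ x ∈ G.U, ContDiffAt ℝ ∞ r x := fun x hx =>
    hP.smooth_r.contDiffAt (G.isOpen_U.mem_nhds hx)
  have hts : ∀ x ∈ G.U, ContDiffAt ℝ ∞ t x := fun x hx =>
    hP.smooth_t.contDiffAt (G.isOpen_U.mem_nhds hx)
  -- Under `ξ₀` the weights of `r` and `c i` are `-1` and `+1`, so they cancel in the product; all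
  -- other derivatives of both factors vanish.
  have hk : ∀ i, ∃ k, ∀ x ∈ G.U, r x * c i x = k := by
    intro i
    refine is_const_on_U (G := G) (fun x hx => ((hrs x hx).differentiableAt (by simp)).mul
      ((hO.smooth_c i x hx).differentiableAt (by simp))) fun x hx => ?_
    have dr := ((hrs x hx).differentiableAt (by simp)).hasFDerivAt
    have dc := ((hO.smooth_c i x hx).differentiableAt (by simp)).hasFDerivAt
    rw [(dr.fun_mul dc).fderiv]
    have em := hP.ξm_r x hx
    have e0 := hP.ξ0_r x hx
    simp only [along] at em e0
    refine hO.clm_eq_zero hx ?_ ?_ (fun j => ?_) fun y hy => ?_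
    · simp [em, (hO.along_ξm hx).2.2]
    · simp [e0, (hO.along_ξ0 hx).2.2]; ring
    · have := hP.m_r j x hx
      simp only [along] at this
      simp [this, (hO.along_m hx j).2.2]
    · simp [hO.fderiv_r_isPerp hP hx hy, (hO.fderiv_isPerp hx hy).2.2]
  choose k hk using hk
  refine ⟨fun i => -k i, fun x hx => ?_, hts, fun i x hx => ?_, fun x hx => ?_⟩
  · exact ((contDiffAt_const.div ((hrs x hx).pow 2) (pow_ne_zero 2 (hP.r_ne x hx))).sub
      ((hts x hx).pow 2)).div_const 2
  · exact contDiffAt_const.div (hrs x hx) (hP.r_ne x hx)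
  · obtain ⟨h1, h2⟩ := hO.eq_of_isPoincare hP hx
    have hr := hP.r_ne x hx
    rw [hO.ξp_eq x hx, ← h2, h1]
    congr 1
    · congr 2; ring
    · refine Finset.sum_congr rfl fun i _ => ?_
      congr 1
      rw [neg_neg, ← hk i x hx]
      field_simp

section Poincare

variable {t r : Pt d → ℝ} {k : Fin n → ℝ} (hP : G.IsPoincare t r)
  (hO : G.OrbitCoeffs (fun x => (1 / r x ^ 2 - t x ^ 2) / 2) t (fun i x => -k i / r x))
include hP hO

/-- This is `g_temporal_m` with `2a + b² = 1/r²` and `c^i = -k^i / r`. -/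
theorem IsPoincare.g_ξm_m (hx : x ∈ G.U) (j : Fin n) :
    G.g x (G.ξm x) (G.m j x) = r x * ∑ i, k i * G.g x (G.m i x) (G.m j x) := by
  have h := hO.g_temporal_m hx j
  have hr := hP.r_ne x hx
  have hsum : ∑ i, -k i / r x * G.g x (G.m i x) (G.m j x) =
      -(1 / r x) * ∑ i, k i * G.g x (G.m i x) (G.m j x) := by
    rw [Finset.mul_sum]; exact Finset.sum_congr rfl fun i _ => by ring
  simp only [temporal, map_add, map_sum, map_smul, add_apply, sum_apply, smul_apply, smul_eq_mul,
    hsum] at h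
  field_simp at h
  linear_combination h

theorem IsPoincare.kPot_eq (hx : x ∈ G.U) : G.kPot r x = k := by
  have hr := hP.r_ne x hx
  have h1 : (fun j => G.g x (G.ξm x) (G.m j x) / r x) = (G.gPhiPhi x).mulVec k := by
    funext j
    rw [hP.g_ξm_m hO hx, mul_div_cancel_left₀ _ hr]
    simp only [Matrix.mulVec, dotProduct, gPhiPhi, Matrix.of_apply]
    exact Finset.sum_congr rfl fun i _ => by rw [(G.lorentzian x hx).1, mul_comm]
  rw [kPot, h1, Matrix.mulVec_mulVec, Matrix.nonsing_inv_mul _ (det_gPhiPhi hx),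
    Matrix.one_mulVec]

/-- The expansion of `ξ₊`, multiplied by `-r` and rearranged. -/
theorem IsPoincare.nXi_eq (hx : x ∈ G.U) : G.nXi (t x) (r x) x = ∑ i, k i • G.m i x := by
  have hr := hP.r_ne x hx
  have hsum : ∑ i, (-k i / r x) • G.m i x = (-(1 / r x)) • ∑ i, k i • G.m i x := by
    rw [Finset.smul_sum]
    exact Finset.sum_congr rfl fun i _ => by rw [smul_smul]; congr 1; ring
  rw [nXi, hO.ξp_eq x hx, hsum]
  match_scalars
  · field_simp; ring
  · ring
  · field_simp

end Poincare
end NHEG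

/-! ### Gauge fields and constancy of `e` -/

theorem snd_fderiv_symm {E F : Type*} [NormedAddCommGroup E] [NormedSpace ℝ E]
    [NormedAddCommGroup F] [NormedSpace ℝ F] {f : E → F} {x : E} (hf : ContDiffAt ℝ ∞ f x)
    (u v : E) : fderiv ℝ (fderiv ℝ f) x u v = fderiv ℝ (fderiv ℝ f) x v u :=
  (hf.isSymmSndFDerivAt (by
    rw [minSmoothness_of_isRCLikeNormedField]
    exact WithTop.coe_le_coe.2 (le_top : (2 : ℕ∞) ≤ ⊤))).eq u v

theorem differentiableAt_fderiv {E F : Type*} [NormedAddCommGroup E] [NormedSpace ℝ E]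
    [NormedAddCommGroup F] [NormedSpace ℝ F] {f : E → F} {x : E} (hf : ContDiffAt ℝ ∞ f x) :
    DifferentiableAt ℝ (fderiv ℝ f) x :=
  (hf.fderiv_right (m := 1) (by norm_cast)).differentiableAt (by simp)

/-- If `∑ f i • d(h i)` is exact, then `∑ d(f i) ∧ d(h i) = 0`. -/
theorem sum_wedge_eq_zero {ι E : Type*} [Fintype ι] [NormedAddCommGroup E] [NormedSpace ℝ E]
    {f h : ι → E → ℝ} {Λ : E → ℝ} {x : E} (hf : ∀ i, DifferentiableAt ℝ (f i) x)
    (hh : ∀ i, ContDiffAt ℝ ∞ (h i) x) (hΛ : ContDiffAt ℝ ∞ Λ x)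
    (heq : fderiv ℝ Λ =ᶠ[nhds x] fun y => ∑ i, f i y • fderiv ℝ (h i) y) (u v : E) :
    ∑ i, fderiv ℝ (f i) x u * fderiv ℝ (h i) x v =
      ∑ i, fderiv ℝ (f i) x v * fderiv ℝ (h i) x u := by
  have hd := HasFDerivAt.fun_sum fun i (_ : i ∈ Finset.univ) =>
    (hf i).hasFDerivAt.fun_smul (differentiableAt_fderiv (hh i)).hasFDerivAt
  have hs := snd_fderiv_symm hΛ u v
  rw [heq.fderiv_eq, hd.fderiv] at hs
  simp only [sum_apply, add_apply, smul_apply, ContinuousLinearMap.smulRight_apply, smul_eq_mul,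
    Finset.sum_add_distrib] at hs
  have hs2 : ∑ i, f i x * fderiv ℝ (fderiv ℝ (h i)) x u v =
      ∑ i, f i x * fderiv ℝ (fderiv ℝ (h i)) x v u :=
    Finset.sum_congr rfl fun i _ => by rw [snd_fderiv_symm (hh i)]
  linarith

theorem fderiv_clm_apply_field {d : ℕ} {A : OneForm d} {Y : VField d} {x : Pt d}
    (hA : DifferentiableAt ℝ A x) (hY : DifferentiableAt ℝ Y x) (v : Pt d) :
    fderiv ℝ (fun y => A y (Y y)) x v = fderiv ℝ A x v (Y x) + A x (fderiv ℝ Y x v) := by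
  rw [(hA.hasFDerivAt.clm_apply hY.hasFDerivAt).fderiv]
  simp [add_comm]

theorem fderiv_clm_apply_along {d : ℕ} {A : OneForm d} {X Y : VField d} {x : Pt d}
    (hA : DifferentiableAt ℝ A x) (hY : DifferentiableAt ℝ Y x) :
    fderiv ℝ (fun y => A y (Y y)) x (X x) =
      lieOne X A x (Y x) + A x (VectorField.lieBracket ℝ X Y x) := by
  rw [fderiv_clm_apply_field hA hY]
  simp [lieOne, VectorField.lieBracket]

namespace NHEG

variable {d n N : ℕ} {G : NHEG d n N} {x : Pt d}

/-- The gauge analogue of `killing_coeffs`: invariance under the frame fields leaves only the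
differentials of the coefficients. -/
theorem OrbitCoeffs.lieOne_ξp {a b : Pt d → ℝ} {c : Fin n → Pt d → ℝ}
    (hO : G.OrbitCoeffs a b c) (hx : x ∈ G.U) (p : Fin N) (v : Pt d) :
    lieOne G.ξp (G.A p) x v = G.A p x (G.ξm x) * fderiv ℝ a x v +
      G.A p x (G.ξ0 x) * fderiv ℝ b x v + ∑ i, G.A p x (G.m i x) * fderiv ℝ (c i) x v := by
  have hm := G.gauge_ξm p x hx v
  have h0 := G.gauge_ξ0 p x hx v
  have hi : ∑ i, c i x * lieOne (G.m i) (G.A p) x v = 0 :=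
    Finset.sum_eq_zero fun i _ => by rw [G.gauge_m p i x hx v, mul_zero]
  simp only [lieOne, mul_add, Finset.sum_add_distrib] at hm h0 hi
  simp only [lieOne, hO.ξp_eq x hx, hO.fderiv_ξp hx, map_add, map_sum, map_smul, add_apply,
    sum_apply, smul_apply, smul_eq_mul]
  simp_rw [mul_comm (G.A p x (G.m _ x))]
  linear_combination a x * hm + b x * h0 + hi

/-- Taking `d` of `L_{ξ₊} A = dΛ` gives a vanishing sum of wedges `d(A(X)) ∧ d(coefficient)` over
the frame fields `X`. Evaluated on `(y, ξ₋)` and `(y, ξ₀)` it yields two relations, from which the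
derivative of `A(ξ₀)` is eliminated. -/
theorem OrbitCoeffs.fderiv_gauge_isPerp {a b : Pt d → ℝ} {c : Fin n → Pt d → ℝ}
    (hO : G.OrbitCoeffs a b c) (hx : x ∈ G.U) (p : Fin N) {y : Pt d} (hy : G.IsPerp x y) :
    (2 * a x + b x ^ 2) * fderiv ℝ (fun z => G.A p z (G.ξm z)) x y +
      ∑ i, c i x * fderiv ℝ (fun z => G.A p z (G.m i z)) x y = 0 := by
  obtain ⟨Λ, hΛ, hgauge⟩ := G.gauge_ξp p
  have dA := (contDiffAt_A p hx).differentiableAt (by simp)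
  have key := sum_wedge_eq_zero (x := x) (Λ := Λ)
    (f := Sum.elim ![fun z => G.A p z (G.ξm z), fun z => G.A p z (G.ξ0 z)]
      fun i z => G.A p z (G.m i z)) (h := Sum.elim ![a, b] c)
    (by
      rintro (j | i)
      · fin_cases j
        · exact dA.clm_apply ((contDiffAt_ξm hx).differentiableAt (by simp))
        · exact dA.clm_apply ((contDiffAt_ξ0 hx).differentiableAt (by simp))
      · exact dA.clm_apply ((contDiffAt_m i hx).differentiableAt (by simp)))
    (by
      rintro (j | i)
      · fin_cases j
        · exact hO.smooth_a x hx
        · exact hO.smooth_b x hx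
      · exact hO.smooth_c i x hx)
    (hΛ.contDiffAt (G.isOpen_U.mem_nhds hx))
    (by
      filter_upwards [G.isOpen_U.mem_nhds hx] with z hz
      ext1 v
      rw [← hgauge z hz, hO.lieOne_ξp hz]
      simp [Fintype.sum_sum_type, Fin.sum_univ_two]) y
  obtain ⟨ha, hb, hc⟩ := hO.fderiv_isPerp hx hy
  obtain ⟨am, bm, cm⟩ := hO.along_ξm hx
  obtain ⟨a0, b0, c0⟩ := hO.along_ξ0 hx
  have k1 := key (G.ξm x)
  have k2 := key (G.ξ0 x)
  simp [Fintype.sum_sum_type, Fin.sum_univ_two, ha, hb, hc, am, bm, cm] at k1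
  simp [Fintype.sum_sum_type, Fin.sum_univ_two, ha, hb, hc, a0, b0, c0] at k2
  simp_rw [mul_comm (c _ x)]
  linear_combination k2 - b x * k1

theorem IsPoincare.exists_ePot {t r : Pt d → ℝ} {k : Fin n → ℝ} (hP : G.IsPoincare t r)
    (hO : G.OrbitCoeffs (fun x => (1 / r x ^ 2 - t x ^ 2) / 2) t (fun i x => -k i / r x))
    (p : Fin N) : ∃ e : ℝ, ∀ x ∈ G.U, G.ePot r p x = e := by
  have hd : ∀ x ∈ G.U, HasFDerivAt
      (fun x => ∑ i, G.A p x (G.m i x) * k i - G.A p x (G.ξm x) * (r x)⁻¹)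
      (∑ i, k i • fderiv ℝ (fun z => G.A p z (G.m i z)) x -
        (G.A p x (G.ξm x) • (-(r x ^ 2)⁻¹ • fderiv ℝ r x) +
          (r x)⁻¹ • fderiv ℝ (fun z => G.A p z (G.ξm z)) x)) x := by
    intro x hx
    have dA := (contDiffAt_A p hx).differentiableAt (by simp)
    have dm := (dA.clm_apply ((contDiffAt_ξm hx).differentiableAt (by simp))).hasFDerivAt
    have di := fun i =>
      (dA.clm_apply ((contDiffAt_m i hx).differentiableAt (by simp))).hasFDerivAt
    have dr := ((hP.smooth_r.contDiffAt (G.isOpen_U.mem_nhds hx)).differentiableAt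
      (by simp)).hasFDerivAt
    exact (HasFDerivAt.fun_sum fun i (_ : i ∈ Finset.univ) => (di i).mul_const (k i)).fun_sub
      (dm.fun_mul ((hasDerivAt_inv (hP.r_ne x hx)).comp_hasFDerivAt x dr))
  obtain ⟨e, he⟩ := is_const_on_U (G := G) (fun x hx => (hd x hx).differentiableAt) (by
    intro x hx
    rw [(hd x hx).fderiv]
    have hr := hP.r_ne x hx
    have dA := (contDiffAt_A p hx).differentiableAt (by simp)
    have em := hP.ξm_r x hx
    have e0 := hP.ξ0_r x hx
    simp only [along] at em e0
    have hs : ∀ (X : VField d) j, VectorField.lieBracket ℝ X (G.m j) x = 0 →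
        VectorField.lieBracket ℝ (G.m j) X x = 0 := fun X j hX => by
      rw [VectorField.lieBracket_swap]; simp [hX]
    have hLm := fun X : VField d => fderiv_clm_apply_along (X := X) dA
      ((contDiffAt_ξm hx).differentiableAt (by simp))
    have hLi := fun (X : VField d) i => fderiv_clm_apply_along (X := X) dA
      ((contDiffAt_m i hx).differentiableAt (by simp))
    refine hO.clm_eq_zero hx ?_ ?_ (fun j => ?_) fun y hy => ?_
    · simp [hLm, hLi, em, G.gauge_ξm p x hx, G.bracket_ξm_m _ x hx]
    -- Both `A(ξ₋)` and `r` have weight `-1` under `ξ₀`, so their quotient is invariant.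
    · simp [hLm, hLi, e0, G.gauge_ξ0 p x hx, G.bracket_ξ0_m _ x hx, G.bracket_0m x hx]
      field_simp
      ring
    · have := hP.m_r j x hx
      simp only [along] at this
      simp [hLm, hLi, this, G.gauge_m p j x hx, G.bracket_m_m _ _ x hx,
        hs _ j (G.bracket_ξm_m j x hx)]
    · have h1 := hO.fderiv_gauge_isPerp hx p hy
      have hsum : ∑ i, -k i / r x * fderiv ℝ (fun z => G.A p z (G.m i z)) x y =
          -(1 / r x) * ∑ i, k i * fderiv ℝ (fun z => G.A p z (G.m i z)) x y := by
        rw [Finset.mul_sum]; exact Finset.sum_congr rfl fun i _ => by ring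
      rw [hsum] at h1
      simp [hO.fderiv_r_isPerp hP hx hy]
      field_simp at h1 ⊢
      linear_combination -h1)
  refine ⟨e, fun x hx => ?_⟩
  rw [← he x hx, ePot, hP.kPot_eq hO hx, div_eq_mul_inv]

end NHEG

/-! ### Cartan calculus for metric duals of Killing vectors -/

section Killing

variable {d : ℕ} {g : TwoTensor d} {X Z K : VField d} {x : Pt d}

theorem fderiv_lower (hg : DifferentiableAt ℝ g x) (hZ : DifferentiableAt ℝ Z x) (v w : Pt d) :
    fderiv ℝ (lower g Z) x v w = fderiv ℝ g x v (Z x) w + g x (fderiv ℝ Z x v) w := by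
  have h : HasFDerivAt (lower g Z) _ x := hg.hasFDerivAt.clm_apply hZ.hasFDerivAt
  rw [h.fderiv]
  simp [add_comm]

theorem fderiv_metric_apply (hg : DifferentiableAt ℝ g x) (hZ : DifferentiableAt ℝ Z x)
    (hX : DifferentiableAt ℝ X x) (v : Pt d) :
    fderiv ℝ (fun y => g y (Z y) (X y)) x v =
      fderiv ℝ g x v (Z x) (X x) + g x (fderiv ℝ Z x v) (X x) + g x (Z x) (fderiv ℝ X x v) := by
  have h := fderiv_clm_apply_field (A := lower g Z) (hg.clm_apply hZ) hX v
  rw [fderiv_lower hg hZ] at h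
  exact h

/-- Cartan's formula for the dual of `Z` along a Killing vector `X`. -/
theorem extDerivOne_lower_killing (hg : DifferentiableAt ℝ g x) (hZ : DifferentiableAt ℝ Z x)
    (hX : DifferentiableAt ℝ X x) (hK : ∀ v w, lieTwo X g x v w = 0) (z : Pt d) :
    extDerivOne (lower g Z) x (X x) z = g x (VectorField.lieBracket ℝ X Z x) z -
      fderiv ℝ (fun y => g y (Z y) (X y)) x z := by
  have h := hK (Z x) z
  simp only [lieTwo] at h
  rw [fderiv_metric_apply hg hZ hX, extDerivOne, fderiv_lower hg hZ, fderiv_lower hg hZ]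
  simp only [VectorField.lieBracket, map_sub, sub_apply]
  linear_combination h

theorem fderiv_metric_killing (hg : DifferentiableAt ℝ g x) (hZ : DifferentiableAt ℝ Z x)
    (hX : DifferentiableAt ℝ X x) (hK : ∀ v w, lieTwo K g x v w = 0) :
    fderiv ℝ (fun y => g y (Z y) (X y)) x (K x) =
      g x (VectorField.lieBracket ℝ K Z x) (X x) + g x (Z x) (VectorField.lieBracket ℝ K X x) := by
  have h := hK (Z x) (X x)
  simp only [lieTwo] at h
  rw [fderiv_metric_apply hg hZ hX]
  simp only [VectorField.lieBracket, map_sub, sub_apply]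
  linear_combination h

/-- At a zero of a Killing vector `K`, the exterior derivative of the dual of `[K, X]` vanishes
on the kernel of the derivative of `K`. -/
theorem extDerivOne_lower_bracket_eq_zero (hg : ContDiffAt ℝ ∞ g x) (hX : ContDiffAt ℝ ∞ X x)
    (hK : ContDiffAt ℝ ∞ K x) (hkill : ∀ᶠ y in nhds x, ∀ v w, lieTwo K g y v w = 0)
    (hZ : ∀ᶠ y in nhds x, Z y = VectorField.lieBracket ℝ K X y) (hK0 : K x = 0) {y y' : Pt d}
    (hy : fderiv ℝ K x y = 0) (hy' : fderiv ℝ K x y' = 0) :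
    extDerivOne (lower g Z) x y y' = 0 := by
  have hη : ContDiffAt ℝ ∞ (lower g X) x := hg.clm_apply hX
  have hgn : ∀ᶠ z in nhds x, DifferentiableAt ℝ g z :=
    ((hg.of_le (m := 1) (mod_cast le_top)).eventually (by simp)).mono
      fun z hz => hz.differentiableAt (by simp)
  have hXn : ∀ᶠ z in nhds x, DifferentiableAt ℝ X z :=
    ((hX.of_le (m := 1) (mod_cast le_top)).eventually (by simp)).mono
      fun z hz => hz.differentiableAt (by simp)
  -- Since `K` is Killing, the dual of `[K, X]` is the Lie derivative of the dual of `X` along `K`.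
  have hev : lower g Z =ᶠ[nhds x] fun z =>
      fderiv ℝ (lower g X) z (K z) + (lower g X z).comp (fderiv ℝ K z) := by
    filter_upwards [hkill, hZ, hgn, hXn] with z hk hz hgz hXz
    ext1 v
    have h := hk (X z) v
    simp only [lieTwo] at h
    rw [lower, hz]
    simp only [add_apply, ContinuousLinearMap.comp_apply, fderiv_lower hgz hXz,
      VectorField.lieBracket, map_sub, sub_apply]
    simp only [lower]
    linear_combination -h
  have dη := (hη.differentiableAt (by simp)).hasFDerivAt
  have ddη := (differentiableAt_fderiv hη).hasFDerivAt
  have dK := (hK.differentiableAt (by simp)).hasFDerivAt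
  have ddK := (differentiableAt_fderiv hK).hasFDerivAt
  have hd := ((ddη.clm_apply dK).fun_add (dη.clm_comp ddK)).fderiv
  -- Where `K = 0`, in directions killed by `dK`, only the term with the second derivative of `K`
  -- survives; it is symmetric and drops out of the exterior derivative.
  have h1 : ∀ u v, fderiv ℝ K x u = 0 → fderiv ℝ K x v = 0 →
      fderiv ℝ (lower g Z) x u v = lower g X x (fderiv ℝ (fderiv ℝ K) x u v) := by
    intro u v hu hv
    rw [hev.fderiv_eq, hd]
    simp [hu, hv, hK0]
  rw [extDerivOne, h1 _ _ hy hy', h1 _ _ hy' hy, snd_fderiv_symm hK, sub_self]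

end Killing

/-! ### Constant combinations of the generators -/

namespace NHEG

variable {d n N : ℕ} {G : NHEG d n N} {x : Pt d} {k : Fin n → ℝ}

variable (G) in
/-- The Killing vector `k^i m_i` with constant `k^i`. -/
def kField (k : Fin n → ℝ) : VField d := fun x => ∑ i, k i • G.m i x

variable (G) in
/-- Constant combinations of `ξ₋, ξ₀, ξ₊` and `k^i m_i`. -/
def gen (k : Fin n → ℝ) (p q u κ : ℝ) : VField d := fun x =>
  p • G.ξm x + q • G.ξ0 x + u • G.ξp x + κ • G.kField k x

theorem contDiffAt_kField (hx : x ∈ G.U) : ContDiffAt ℝ ∞ (G.kField k) x :=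
  ContDiffAt.sum fun i _ => (contDiffAt_m i hx).const_smul (k i)

theorem contDiffAt_gen (hx : x ∈ G.U) (p q u κ : ℝ) : ContDiffAt ℝ ∞ (G.gen k p q u κ) x :=
  ((((contDiffAt_ξm hx).const_smul p).add ((contDiffAt_ξ0 hx).const_smul q)).add
    ((contDiffAt_ξp hx).const_smul u)).add ((contDiffAt_kField hx).const_smul κ)

theorem fderiv_kField (hx : x ∈ G.U) (v : Pt d) :
    fderiv ℝ (G.kField k) x v = ∑ i, k i • fderiv ℝ (G.m i) x v := by
  have h : HasFDerivAt (G.kField k) _ x := HasFDerivAt.fun_sum fun i (_ : i ∈ Finset.univ) =>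
    ((contDiffAt_m i hx).differentiableAt (by simp)).hasFDerivAt.const_smul (k i)
  rw [h.fderiv]
  simp

theorem fderiv_gen (hx : x ∈ G.U) (p q u κ : ℝ) (v : Pt d) :
    fderiv ℝ (G.gen k p q u κ) x v = p • fderiv ℝ G.ξm x v + q • fderiv ℝ G.ξ0 x v +
      u • fderiv ℝ G.ξp x v + κ • fderiv ℝ (G.kField k) x v := by
  have dm := ((contDiffAt_ξm hx).differentiableAt (by simp)).hasFDerivAt
  have d0 := ((contDiffAt_ξ0 hx).differentiableAt (by simp)).hasFDerivAt
  have dp := ((contDiffAt_ξp hx).differentiableAt (by simp)).hasFDerivAt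
  have dk := ((contDiffAt_kField (k := k) hx).differentiableAt (by simp)).hasFDerivAt
  have h : HasFDerivAt (G.gen k p q u κ) _ x :=
    (((dm.const_smul p).fun_add (d0.const_smul q)).fun_add (dp.const_smul u)).fun_add
      (dk.const_smul κ)
  rw [h.fderiv]
  simp

theorem lieTwo_kField (hx : x ∈ G.U) (v w : Pt d) : lieTwo (G.kField k) G.g x v w = 0 := by
  have hi : ∑ i, k i * lieTwo (G.m i) G.g x v w = 0 :=
    Finset.sum_eq_zero fun i _ => by rw [G.killing_m i x hx v w, mul_zero]
  simp only [lieTwo, mul_add, Finset.sum_add_distrib] at hi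
  rw [← hi]
  simp [lieTwo, kField, fderiv_kField hx]

theorem lieTwo_gen (hx : x ∈ G.U) (p q u κ : ℝ) (v w : Pt d) :
    lieTwo (G.gen k p q u κ) G.g x v w = 0 := by
  have hm := G.killing_ξm x hx v w
  have h0 := G.killing_ξ0 x hx v w
  have hp := G.killing_ξp x hx v w
  have hk := lieTwo_kField (k := k) hx v w
  simp only [lieTwo] at hm h0 hp hk
  simp only [lieTwo, gen, fderiv_gen hx, map_add, map_smul, add_apply, smul_apply, smul_eq_mul]
  linear_combination p * hm + q * h0 + u * hp + κ * hk

theorem lieBracket_kField (hx : x ∈ G.U) {X : VField d}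
    (hX : ∀ i, VectorField.lieBracket ℝ X (G.m i) x = 0) :
    VectorField.lieBracket ℝ X (G.kField k) x = 0 := by
  have h : VectorField.lieBracket ℝ X (G.kField k) x =
      ∑ i, k i • VectorField.lieBracket ℝ X (G.m i) x := by
    simp [VectorField.lieBracket, fderiv_kField hx, kField, smul_sub]
  rw [h]
  simp [hX]

theorem lieBracket_gen (hx : x ∈ G.U) (X : VField d) (p q u κ : ℝ) :
    VectorField.lieBracket ℝ X (G.gen k p q u κ) x = p • VectorField.lieBracket ℝ X G.ξm x +
      q • VectorField.lieBracket ℝ X G.ξ0 x + u • VectorField.lieBracket ℝ X G.ξp x +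
      κ • VectorField.lieBracket ℝ X (G.kField k) x := by
  simp only [VectorField.lieBracket, fderiv_gen hx, gen, map_add, map_smul]
  module

theorem lieBracket_gen_m (hx : x ∈ G.U) (p q u κ : ℝ) (j : Fin n) :
    VectorField.lieBracket ℝ (G.gen k p q u κ) (G.m j) x = 0 := by
  have hs : ∀ X : VField d, VectorField.lieBracket ℝ X (G.m j) x = 0 →
      VectorField.lieBracket ℝ (G.m j) X x = 0 := fun X hX => by
    rw [VectorField.lieBracket_swap]; simp [hX]
  rw [VectorField.lieBracket_swap, lieBracket_gen hx,
    hs _ (G.bracket_ξm_m j x hx), hs _ (G.bracket_ξ0_m j x hx), hs _ (G.bracket_ξp_m j x hx),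
    lieBracket_kField hx fun i => G.bracket_m_m j i x hx]
  simp

theorem lieBracket_m_gen (hx : x ∈ G.U) (p q u κ : ℝ) (j : Fin n) :
    VectorField.lieBracket ℝ (G.m j) (G.gen k p q u κ) x = 0 := by
  rw [VectorField.lieBracket_swap, lieBracket_gen_m hx, neg_zero]

/-- The structure constants of `sl(2,ℝ) ⊕ u(1)`. -/
theorem lieBracket_gen_gen (hx : x ∈ G.U) (p q u κ p' q' u' κ' : ℝ) :
    VectorField.lieBracket ℝ (G.gen k p q u κ) (G.gen k p' q' u' κ') x =
      G.gen k (p * q' - q * p') (p * u' - u * p') (q * u' - u * q') 0 x := by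
  have hs : ∀ X Y : VField d, VectorField.lieBracket ℝ X Y x =
      -VectorField.lieBracket ℝ Y X x := fun X Y => by
    rw [VectorField.lieBracket_swap]
  have hk : VectorField.lieBracket ℝ (G.gen k p q u κ) (G.kField k) x = 0 :=
    lieBracket_kField hx fun i => lieBracket_gen_m hx p q u κ i
  have hkm := lieBracket_kField (k := k) hx fun i => G.bracket_ξm_m i x hx
  have hk0 := lieBracket_kField (k := k) hx fun i => G.bracket_ξ0_m i x hx
  have hkp := lieBracket_kField (k := k) hx fun i => G.bracket_ξp_m i x hx
  rw [lieBracket_gen hx, hk, hs _ G.ξm, hs _ G.ξ0, hs _ G.ξp, lieBracket_gen hx,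
    lieBracket_gen hx, lieBracket_gen hx, hkm, hk0, hkp, hs G.ξm G.ξ0, hs G.ξp G.ξm,
    hs G.ξp G.ξ0, G.bracket_0m x hx, G.bracket_0p x hx, G.bracket_mp x hx]
  simp only [VectorField.lieBracket_self, gen]
  simp only [Pi.zero_apply]
  module

theorem extDerivOne_gen (hx : x ∈ G.U) (p q u κ : ℝ) (v w : Pt d) :
    extDerivOne (lower G.g (G.gen k p q u κ)) x v w =
      p * extDerivOne (lower G.g G.ξm) x v w + q * extDerivOne (lower G.g G.ξ0) x v w +
      u * extDerivOne (lower G.g G.ξp) x v w +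
      κ * extDerivOne (lower G.g (G.kField k)) x v w := by
  have dg := (contDiffAt_g hx).differentiableAt (by simp)
  have dm := (contDiffAt_ξm hx).differentiableAt (by simp)
  have d0 := (contDiffAt_ξ0 hx).differentiableAt (by simp)
  have dp := (contDiffAt_ξp hx).differentiableAt (by simp)
  have dk := (contDiffAt_kField (k := k) hx).differentiableAt (by simp)
  have dgen := (contDiffAt_gen (k := k) hx p q u κ).differentiableAt (by simp)
  simp only [extDerivOne, fderiv_lower dg dm, fderiv_lower dg d0, fderiv_lower dg dp,
    fderiv_lower dg dk, fderiv_lower dg dgen, fderiv_gen hx, gen, map_add, map_smul, add_apply,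
    smul_apply, smul_eq_mul]
  ring

end NHEG

/-! ### Inner products and exterior derivatives in Poincaré coordinates -/

namespace NHEG

variable {d n N : ℕ} {G : NHEG d n N} {x : Pt d} {k : Fin n → ℝ} {t r : Pt d → ℝ}
  (hP : G.IsPoincare t r)
  (hO : G.OrbitCoeffs (fun x => (1 / r x ^ 2 - t x ^ 2) / 2) t (fun i x => -k i / r x))

theorem zetaH_eq_gen (k : Fin n → ℝ) (tH rH : ℝ) : G.zetaH k tH rH =
    G.gen k (-(tH ^ 2 * rH ^ 2 - 1) / (2 * rH)) (tH * rH) (-rH) (-1) := by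
  funext x
  simp only [zetaH, nXi, gen, kField]
  module

theorem sum_neg_div_smul_m (k : Fin n → ℝ) (ρ : ℝ) (x : Pt d) :
    ∑ i, (-k i / ρ) • G.m i x = (-(1 / ρ)) • G.kField k x := by
  rw [kField, Finset.smul_sum]
  exact Finset.sum_congr rfl fun i _ => by rw [smul_smul]; congr 1; ring

namespace IsPoincare

include hO in
theorem ξp_eq (hx : x ∈ G.U) : G.ξp x = ((1 / r x ^ 2 - t x ^ 2) / 2) • G.ξm x +
    t x • G.ξ0 x + (-(1 / r x)) • G.kField k x := by
  rw [hO.ξp_eq x hx, sum_neg_div_smul_m]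

include hP hO

/-- Orthogonal expansion of a generator on its orbit. -/
theorem gen_eq (hx : x ∈ G.U) (p q u κ : ℝ) : G.gen k p q u κ x =
    (r x ^ 2 * (p + t x * q + u * (1 / r x ^ 2 + t x ^ 2) / 2)) •
      G.temporal (fun x => (1 / r x ^ 2 - t x ^ 2) / 2) t (fun i x => -k i / r x) x -
    (q + u * t x) • G.radial t x +
    (r x * (p + t x * q + u * t x ^ 2 / 2) - u / (2 * r x) + κ) • G.kField k x := by
  have hr := hP.r_ne x hx
  simp only [gen, ξp_eq hO hx, temporal, radial, sum_neg_div_smul_m]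
  match_scalars
  · field_simp; ring
  · ring
  · field_simp; ring

theorem g_gen_m (hx : x ∈ G.U) (p q u κ : ℝ) (j : Fin n) :
    G.g x (G.gen k p q u κ x) (G.m j x) =
      (r x * (p + t x * q + u * t x ^ 2 / 2) - u / (2 * r x) + κ) *
        G.g x (G.kField k x) (G.m j x) := by
  rw [gen_eq hP hO hx]
  simp only [map_add, map_sub, map_smul, add_apply, sub_apply, smul_apply, smul_eq_mul,
    hO.g_temporal_m hx, hO.g_radial_m hx]
  ring

theorem g_gen_gen (hx : x ∈ G.U) (p q u κ p' q' u' κ' : ℝ) :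
    G.g x (G.gen k p q u κ x) (G.gen k p' q' u' κ' x) =
      ((q + u * t x) * (q' + u' * t x) -
        r x ^ 2 * (p + t x * q + u * (1 / r x ^ 2 + t x ^ 2) / 2) *
          (p' + t x * q' + u' * (1 / r x ^ 2 + t x ^ 2) / 2)) *
        G.g x (G.radial t x) (G.radial t x) +
      (r x * (p + t x * q + u * t x ^ 2 / 2) - u / (2 * r x) + κ) *
        (r x * (p' + t x * q' + u' * t x ^ 2 / 2) - u' / (2 * r x) + κ') *
        G.g x (G.kField k x) (G.kField k x) := by
  have hr := hP.r_ne x hx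
  have hs := (G.lorentzian x hx).1
  have hrt := hO.g_radial_temporal hx
  have htr := hrt
  rw [hs] at htr
  have htk : G.g x (G.temporal (fun x => (1 / r x ^ 2 - t x ^ 2) / 2) t
      (fun i x => -k i / r x) x) (G.kField k x) = 0 := by
    rw [kField, map_sum]
    exact Finset.sum_eq_zero fun i _ => by rw [map_smul, hO.g_temporal_m hx, smul_zero]
  have hrk : G.g x (G.radial t x) (G.kField k x) = 0 := by simp [kField, hO.g_radial_m hx]
  have hkt := htk
  have hkr := hrk
  rw [hs] at hkt hkr
  rw [gen_eq hP hO hx, gen_eq hP hO hx]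
  simp only [map_add, map_sub, map_smul, add_apply, sub_apply, smul_apply, smul_eq_mul,
    hrt, htr, htk, hrk, hkt, hkr, hO.g_temporal_temporal hx]
  field_simp
  ring

omit hP in
theorem g_gen_perp (hx : x ∈ G.U) (p q u κ : ℝ) {y : Pt d} (hy : G.IsPerp x y) :
    G.g x (G.gen k p q u κ x) y = 0 := by
  have hk : G.g x (G.kField k x) y = 0 := by simp [kField, hy.m]
  simp [gen, ξp_eq hO hx, hy.ξm, hy.ξ0, hk]

/-- A function of `t, r` vanishing at a point does not contribute to derivatives orthogonal to
the orbit there. -/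
theorem fderiv_perp_mul (hx : x ∈ G.U) {y : Pt d} (hy : G.IsPerp x y) {Φ : ℝ × ℝ → ℝ}
    (hΦ : DifferentiableAt ℝ Φ (t x, r x)) (hΦ0 : Φ (t x, r x) = 0) {f : Pt d → ℝ}
    (hf : DifferentiableAt ℝ f x) :
    HasFDerivAt (fun z => Φ (t z, r z) * f z) (fderiv ℝ (fun z => Φ (t z, r z) * f z) x) x ∧
      fderiv ℝ (fun z => Φ (t z, r z) * f z) x y = 0 := by
  have dt := ((hO.smooth_b x hx).differentiableAt (by simp)).hasFDerivAt
  have dr := ((hP.smooth_r.contDiffAt (G.isOpen_U.mem_nhds hx)).differentiableAt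
    (by simp)).hasFDerivAt
  have h := (HasFDerivAt.comp (g := Φ) (f := fun z => (t z, r z)) x hΦ.hasFDerivAt
    (dt.prodMk dr)).mul hf.hasFDerivAt
  have h' : HasFDerivAt (fun z => Φ (t z, r z) * f z) _ x := h
  refine ⟨h'.differentiableAt.hasFDerivAt, ?_⟩
  rw [h'.fderiv]
  simp [hΦ0, (hO.fderiv_isPerp hx hy).2.1, hO.fderiv_r_isPerp hP hx hy, Prod.mk_zero_zero]

omit hP in
/-- Exterior derivatives of the generators, restricted to the normal directions. -/
theorem extDerivOne_perp (hx : x ∈ G.U) {y y' : Pt d} (hy : G.IsPerp x y)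
    (hy' : G.IsPerp x y') :
    extDerivOne (lower G.g G.ξ0) x y y' = t x * extDerivOne (lower G.g G.ξm) x y y' ∧
    2 * extDerivOne (lower G.g G.ξp) x y y' =
      -(1 / r x ^ 2 - t x ^ 2) * extDerivOne (lower G.g G.ξm) x y y' ∧
    (1 / r x) * extDerivOne (lower G.g (G.kField k)) x y y' =
      1 / r x ^ 2 * extDerivOne (lower G.g G.ξm) x y y' := by
  set a := (1 / r x ^ 2 - t x ^ 2) / 2 with ha
  have hperp : ∀ z, G.IsPerp x z →
      fderiv ℝ G.ξp x z = a • fderiv ℝ G.ξm x z + t x • fderiv ℝ G.ξ0 x z +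
        (-(1 / r x)) • fderiv ℝ (G.kField k) x z := by
    intro z hz
    obtain ⟨h1, h2, h3⟩ := hO.fderiv_isPerp hx hz
    rw [hO.fderiv_ξp hx, h1, h2, fderiv_kField hx, Finset.smul_sum]
    simp only [h3, zero_smul, Finset.sum_const_zero, add_zero, zero_add]
    congr 1
    exact Finset.sum_congr rfl fun i _ => by rw [smul_smul]; congr 1; ring
  have dg := (contDiffAt_g hx).differentiableAt (by simp)
  have dm := (contDiffAt_ξm hx).differentiableAt (by simp)
  have d0 := (contDiffAt_ξ0 hx).differentiableAt (by simp)
  have dp := (contDiffAt_ξp hx).differentiableAt (by simp)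
  have dk := (contDiffAt_kField (k := k) hx).differentiableAt (by simp)
  have hplus : extDerivOne (lower G.g G.ξp) x y y' =
      a * extDerivOne (lower G.g G.ξm) x y y' + t x * extDerivOne (lower G.g G.ξ0) x y y' -
        (1 / r x) * extDerivOne (lower G.g (G.kField k)) x y y' := by
    simp only [extDerivOne, fderiv_lower dg dm, fderiv_lower dg d0, fderiv_lower dg dp,
      fderiv_lower dg dk, hperp y hy, hperp y' hy', ξp_eq hO hx, map_add, map_smul, add_apply,
      smul_apply, smul_eq_mul]
    ring
  -- An isotropy generator: freezing the coefficients of `ξ₊` at `x` gives a Killing field that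
  -- vanishes at `x` and whose derivative annihilates normal vectors, as the coefficients have no
  -- normal derivative.
  have hK0 : G.gen k (-a) (-t x) 1 (1 / r x) x = 0 := by
    simp only [gen, ξp_eq hO hx]; module
  have hKz : ∀ z, G.IsPerp x z → fderiv ℝ (G.gen k (-a) (-t x) 1 (1 / r x)) x z = 0 :=
    fun z hz => by rw [fderiv_gen hx, hperp z hz]; module
  have key : ∀ p q, extDerivOne (lower G.g (G.gen k (-a * q - -t x * p) (-a * 0 - 1 * p)
      (-t x * 0 - 1 * q) 0)) x y y' = 0 := by
    intro p q
    refine extDerivOne_lower_bracket_eq_zero (contDiffAt_g hx) (contDiffAt_gen (k := k) hx p q 0 0)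
      (contDiffAt_gen hx (-a) (-t x) 1 (1 / r x)) ?_ ?_ hK0 (hKz y hy) (hKz y' hy')
    · filter_upwards [G.isOpen_U.mem_nhds hx] with z hz using lieTwo_gen hz _ _ _ _
    · filter_upwards [G.isOpen_U.mem_nhds hx] with z hz
      rw [lieBracket_gen_gen hz]
  -- The brackets of the isotropy generator with `ξ₋` and with `t(x) ξ₋ - ξ₀` give the relations for
  -- `ξ₀` and `ξ₊`; the expansion of `ξ₊` then gives the one for `kField`.
  have k1 := key 1 0
  have k2 := key (t x) (-1)
  rw [extDerivOne_gen hx] at k1 k2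
  have e1 : extDerivOne (lower G.g G.ξ0) x y y' =
      t x * extDerivOne (lower G.g G.ξm) x y y' := by linear_combination -k1
  rw [e1] at k2 hplus
  have e2 : extDerivOne (lower G.g G.ξp) x y y' =
      -a * extDerivOne (lower G.g G.ξm) x y y' := by linear_combination k2
  refine ⟨e1, by rw [e2, ha]; ring, ?_⟩
  have e3 : (1 / r x ^ 2 : ℝ) = 2 * a + t x ^ 2 := by rw [ha]; ring
  rw [e3]
  linear_combination hplus - e2

end IsPoincare
end NHEG

/-! ### Surface gravity on the horizon -/

namespace NHEG

theorem differentiableAt_mComponent (p q u κ t₀ : ℝ) {r₀ : ℝ} (hr : r₀ ≠ 0) :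
    DifferentiableAt ℝ (fun z : ℝ × ℝ => z.2 * (p + z.1 * q + u * z.1 ^ 2 / 2) - u / (2 * z.2) + κ)
      (t₀, r₀) := by
  have : (2 * (t₀, r₀).2) ≠ 0 := mul_ne_zero two_ne_zero hr
  fun_prop (disch := assumption)

theorem differentiableAt_nullComponent (p q u p' q' u' : ℝ) {t₀ r₀ : ℝ} (hr : r₀ ≠ 0) :
    DifferentiableAt ℝ (fun z : ℝ × ℝ => (q + u * z.1) * (q' + u' * z.1) -
      z.2 ^ 2 * (p + z.1 * q + u * (1 / z.2 ^ 2 + z.1 ^ 2) / 2) *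
        (p' + z.1 * q' + u' * (1 / z.2 ^ 2 + z.1 ^ 2) / 2)) (t₀, r₀) := by
  have : ((t₀, r₀).2 ^ 2) ≠ 0 := pow_ne_zero 2 hr
  fun_prop (disch := assumption)

variable {d n N : ℕ} {G : NHEG d n N} {x : Pt d} {k : Fin n → ℝ} {t r : Pt d → ℝ}
  (hP : G.IsPoincare t r)
  (hO : G.OrbitCoeffs (fun x => (1 / r x ^ 2 - t x ^ 2) / 2) t (fun i x => -k i / r x))
  {ε tH rH : ℝ}

namespace IsPoincare

include hP hO

/-- The value of `ζ_H` on its horizon is a multiple of a null vector of the orbit, so the square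
of `dζ_H` reduces to its component along the null plane. -/
theorem extDerivSq_zetaH (hx : x ∈ G.U) (hrH : rH ≠ 0) (hε : ε = 1 ∨ ε = -1)
    (hT : t x + ε / r x = tH + ε / rH) : extDerivSq G.g (G.zetaH k tH rH) x = -8 := by
  have hr := hP.r_ne x hx
  have hs := (G.lorentzian x hx).1
  have ht : t x = tH + ε / rH - ε / r x := by linarith
  have hε2 : ε ^ 2 = 1 := by rcases hε with rfl | rfl <;> norm_num
  set p₀ := -(tH ^ 2 * rH ^ 2 - 1) / (2 * rH) with hp₀
  set w := G.radial t x with hw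
  set s := G.temporal (fun x => (1 / r x ^ 2 - t x ^ 2) / 2) t (fun i x => -k i / r x) x with hs'
  -- The factor makes `g(e, e) = -g(w, w)`, so `w + e` is null; `ε` selects the branch of the
  -- horizon.
  set e := (ε * r x) • s with he
  set T := t x + ε / r x with hTdef
  rw [zetaH_eq_gen, ← hp₀]
  set ζ := G.gen k p₀ (tH * rH) (-rH) (-1) with hζ
  have hww := hO.g_radial_ne_zero hx
  have hrt := hO.g_radial_temporal hx
  have htt := hO.g_temporal_temporal hx
  have dg := (contDiffAt_g hx).differentiableAt (by simp)
  have dζ : DifferentiableAt ℝ ζ x := (contDiffAt_gen hx _ _ _ _).differentiableAt (by simp)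
  have dL : DifferentiableAt ℝ (G.gen k T (-1) 0 (-ε)) x :=
    (contDiffAt_gen hx _ _ _ _).differentiableAt (by simp)
  have dk : DifferentiableAt ℝ (G.kField k) x := (contDiffAt_kField hx).differentiableAt (by simp)
  have dm := fun j => (contDiffAt_m (G := G) j hx).differentiableAt (by simp)
  have dw : DifferentiableAt ℝ (G.radial t) x :=
    (((hO.smooth_b x hx).differentiableAt (by simp)).smul
      ((contDiffAt_ξm hx).differentiableAt (by simp))).sub
      ((contDiffAt_ξ0 hx).differentiableAt (by simp))
  -- With `T` frozen at its value at `x`, the null vector is the value of a Killing field, so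
  -- Cartan's formula applies to it; the same holds for `w` below.
  have hLx : w + e = G.gen k T (-1) 0 (-ε) x := by
    rw [he, hs', hw, radial, temporal, gen, sum_neg_div_smul_m, hTdef]
    match_scalars
    · field_simp; ring
    · ring
    · field_simp
    · ring
  have hWx : w = G.gen k (t x) (-1) 0 0 x := by
    simp [hw, radial, gen, sub_eq_add_neg]
  set F : Pt d →L[ℝ] Pt d →L[ℝ] ℝ :=
    fderiv ℝ (lower G.g ζ) x - (fderiv ℝ (lower G.g ζ) x).flip with hF
  have hFe : ∀ v u, extDerivOne (lower G.g ζ) x v u = F v u := fun v u => rfl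
  have hFs : ∀ v u, F u v = -F v u := fun v u => by rw [← hFe, ← hFe]; simp [extDerivOne]
  -- components along the generators
  have hFm : ∀ j z, F (G.m j x) z = -fderiv ℝ (fun y => G.g y (ζ y) (G.m j y)) x z := by
    intro j z
    rw [← hFe, extDerivOne_lower_killing dg dζ (dm j) (G.killing_m j x hx), lieBracket_m_gen hx]
    simp
  have hFL : ∀ z, F (w + e) z =
      G.g x (VectorField.lieBracket ℝ (G.gen k T (-1) 0 (-ε)) ζ x) z -
        fderiv ℝ (fun y => G.g y (ζ y) (G.gen k T (-1) 0 (-ε) y)) x z := by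
    intro z
    rw [hLx, ← hFe, extDerivOne_lower_killing dg dζ dL (lieTwo_gen hx _ _ _ _)]
  have hFmm : ∀ i j, F (G.m j x) (G.m i x) = 0 := by
    intro i j
    rw [hFm, fderiv_metric_killing dg dζ (dm j) (G.killing_m i x hx), lieBracket_m_gen hx,
      G.bracket_m_m i j x hx]
    simp
  -- The product `g(ζ, m_j)` is a function of `(t, r)` times `g(k^i m_i, m_j)`. That function
  -- vanishes on the horizon and has no normal derivative.
  have hFmy : ∀ j y, G.IsPerp x y → F (G.m j x) y = 0 := by
    intro j y hy
    have h := (fderiv_perp_mul hP hO hx hy (Φ := fun q => q.2 * (p₀ + q.1 * (tH * rH) +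
      -rH * q.1 ^ 2 / 2) - -rH / (2 * q.2) + -1) (differentiableAt_mComponent _ _ _ _ _ hr) (by
        rw [hp₀, ht]
        rcases hε with rfl | rfl <;> field_simp <;> ring)
        ((dg.clm_apply dk).clm_apply (dm j))).2
    have hev : (fun y => G.g y (ζ y) (G.m j y)) =ᶠ[nhds x] fun z =>
        (r z * (p₀ + t z * (tH * rH) + -rH * t z ^ 2 / 2) - -rH / (2 * r z) + -1) *
          G.g z (G.kField k z) (G.m j z) := by
      filter_upwards [G.isOpen_U.mem_nhds hx] with z hz using g_gen_m hP hO hz _ _ _ _ j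
    rw [hFm, hev.fderiv_eq, h, neg_zero]
  -- On normal pairs all the exterior derivatives are multiples of that of `ξ₋`, and the total
  -- coefficient vanishes on the horizon.
  have hFyy : ∀ y y', G.IsPerp x y → G.IsPerp x y' → F y y' = 0 := by
    intro y y' hy hy'
    obtain ⟨h0, hp, hk⟩ := extDerivOne_perp hO hx hy hy'
    have hp' : extDerivOne (lower G.g G.ξp) x y y' =
      -(1 / r x ^ 2 - t x ^ 2) / 2 * extDerivOne (lower G.g G.ξm) x y y' := by linarith
    have hk' : extDerivOne (lower G.g (G.kField k)) x y y' =
        1 / r x * extDerivOne (lower G.g G.ξm) x y y' := by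
      field_simp at hk ⊢; linarith
    rw [← hFe, extDerivOne_gen hx, h0, hp', hk', hp₀, ht]
    rcases hε with rfl | rfl <;> field_simp <;> ring
  -- The bracket of the null generator with `ζ` has no component along the `m_i` at `x`.
  have hFLm : ∀ j, F (w + e) (G.m j x) = 0 := by
    intro j
    rw [hFL, fderiv_metric_killing dg dζ dL (G.killing_m j x hx), lieBracket_m_gen hx,
      lieBracket_m_gen hx, lieBracket_gen_gen hx, g_gen_m hP hO hx]
    simp only [map_zero, zero_apply, add_zero, sub_zero]
    rw [mul_eq_zero]
    left
    rw [hTdef, hp₀, ht]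
    rcases hε with rfl | rfl <;> field_simp <;> ring
  -- The bracket is tangent to the orbit, and both `(t, r)`-dependent factors in the inner product
  -- of `ζ` with the null generator vanish at `x`.
  have hFLy : ∀ y, G.IsPerp x y → F (w + e) y = 0 := by
    intro y hy
    obtain ⟨d1, h1⟩ := fderiv_perp_mul hP hO hx hy (Φ := fun q =>
      (tH * rH + -rH * q.1) * (-1 + 0 * q.1) - q.2 ^ 2 * (p₀ + q.1 * (tH * rH) +
        -rH * (1 / q.2 ^ 2 + q.1 ^ 2) / 2) * (T + q.1 * -1 + 0 * (1 / q.2 ^ 2 + q.1 ^ 2) / 2)) (differentiableAt_nullComponent _ _ _ _ _ _ hr) (by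
        rw [hp₀, hTdef, ht]
        rcases hε with rfl | rfl <;> field_simp <;> ring)
        ((dg.clm_apply dw).clm_apply dw)
    obtain ⟨d2, h2⟩ := fderiv_perp_mul hP hO hx hy (Φ := fun q =>
      (q.2 * (p₀ + q.1 * (tH * rH) + -rH * q.1 ^ 2 / 2) - -rH / (2 * q.2) + -1) *
        (q.2 * (T + q.1 * -1 + 0 * q.1 ^ 2 / 2) - 0 / (2 * q.2) + -ε)) ((differentiableAt_mComponent _ _ _ _ _ hr).fun_mul
          (differentiableAt_mComponent _ _ _ _ _ hr)) (by
        rw [hp₀, hTdef, ht]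
        rcases hε with rfl | rfl <;> field_simp <;> ring)
        ((dg.clm_apply dk).clm_apply dk)
    have hev : (fun y => G.g y (ζ y) (G.gen k T (-1) 0 (-ε) y)) =ᶠ[nhds x] fun z =>
        ((tH * rH + -rH * t z) * (-1 + 0 * t z) - r z ^ 2 * (p₀ + t z * (tH * rH) +
          -rH * (1 / r z ^ 2 + t z ^ 2) / 2) *
            (T + t z * -1 + 0 * (1 / r z ^ 2 + t z ^ 2) / 2)) *
          G.g z (G.radial t z) (G.radial t z) +
        (r z * (p₀ + t z * (tH * rH) + -rH * t z ^ 2 / 2) - -rH / (2 * r z) + -1) *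
          (r z * (T + t z * -1 + 0 * t z ^ 2 / 2) - 0 / (2 * r z) + -ε) *
          G.g z (G.kField k z) (G.kField k z) := by
      filter_upwards [G.isOpen_U.mem_nhds hx] with z hz using g_gen_gen hP hO hz _ _ _ _ _ _ _ _
    rw [hFL, lieBracket_gen_gen hx, g_gen_perp hO hx _ _ _ _ hy, hev.fderiv_eq,
      (d1.fun_add d2).fderiv, add_apply, h1, h2]
    simp
  -- decomposition of the orthogonal complement of the null plane
  have hdec : ∀ z, G.g x e z = 0 → G.g x w z = 0 → ∃ (γ : Fin n → ℝ) (y : Pt d),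
      G.IsPerp x y ∧ z = ∑ i, γ i • G.m i x + y := by
    intro z hez hwz
    obtain ⟨γ, hγ⟩ := exists_sub_m_perp hx z
    refine ⟨γ, z - ∑ i, γ i • G.m i x, ?_, by abel⟩
    have hsz : G.g x s z = 0 := by
      rw [he, map_smul, smul_apply, smul_eq_mul, mul_eq_zero] at hez
      exact hez.resolve_left (mul_ne_zero (by rcases hε with rfl | rfl <;> norm_num) hr)
    refine hO.isPerp_of_orthogonal hx ?_ ?_ hγ
    · rw [map_sub, map_sum, hwz, Finset.sum_eq_zero, sub_zero]
      intro i _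
      rw [map_smul, hO.g_radial_m hx, smul_zero]
    · rw [map_sub, map_sum, hsz, Finset.sum_eq_zero, sub_zero]
      intro i _
      rw [map_smul, hO.g_temporal_m hx, smul_zero]
  have hFww : F w w = 0 := by have := hFs w w; linarith
  -- Since `F w w = 0`, `e` may be replaced by the null generator; as `w` is also the value of a
  -- Killing field, the remaining derivative along `w` is computed from brackets alone.
  have hFew : F e w = 2 * ε * G.g x w w := by
    have h1 : F e w = F (w + e) w := by rw [map_add, add_apply, hFww, zero_add]
    have h2 := fderiv_metric_killing dg dζ dL (lieTwo_gen (k := k) hx (t x) (-1) 0 0)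
    rw [← hWx] at h2
    rw [h1, hFL, h2, lieBracket_gen_gen hx, lieBracket_gen_gen hx, lieBracket_gen_gen hx,
      g_gen_gen hP hO hx, g_gen_gen hP hO hx]
    nth_rewrite 1 [hWx]
    rw [g_gen_gen hP hO hx, hTdef, hp₀, ht]
    generalize G.g x (G.kField k x) (G.kField k x) = K
    rw [← hw]
    generalize G.g x w w = W
    rcases hε with rfl | rfl <;> field_simp <;> ring
  have hfin := extDerivSq_eq (ζ := ζ) (G.lorentzian x hx) (e := e) (w := w) (c := 2 * ε)
    (by rw [he, map_smul, smul_apply, hs, hrt, smul_zero]) hww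
    (by
      simp only [he, map_smul, smul_apply, smul_eq_mul]
      rw [htt]
      field_simp
      linear_combination (-G.g x w w) * hε2)
    (by
      intro z z' h1 h2 h3 h4
      obtain ⟨γ, y, hy, rfl⟩ := hdec z h1 h2
      obtain ⟨γ', y', hy', rfl⟩ := hdec z' h3 h4
      rw [hFe]
      have hym : ∀ i, F y (G.m i x) = 0 := fun i => by rw [hFs, hFmy i y hy, neg_zero]
      simp [hFmm, hFmy _ _ hy', hFyy _ _ hy hy', hym])
    (by
      intro z h1 h2
      obtain ⟨γ, y, hy, rfl⟩ := hdec z h1 h2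
      rw [hFe]
      have h3 : F (w + e) (∑ i, γ i • G.m i x) = 0 := by
        rw [map_sum]
        exact Finset.sum_eq_zero fun i _ => by rw [map_smul, hFLm, smul_zero]
      rw [map_add, h3, hFLy y hy, add_zero]) hFew
  rw [hfin]
  linear_combination -8 * hε2

theorem surfaceGravity_zetaH (hrH : rH ≠ 0) (hx : x ∈ G.horizon t r tH rH) :
    surfaceGravity G.g (G.zetaH k tH rH) x = 1 := by
  obtain ⟨hxU, h | h⟩ := hx
  all_goals rw [surfaceGravity]
  · rw [extDerivSq_zetaH hP hO hxU hrH (Or.inl rfl) h]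
    norm_num
  · rw [extDerivSq_zetaH hP hO hxU hrH (Or.inr rfl) (by rw [neg_div, neg_div]; linarith)]
    norm_num

end IsPoincare
end NHEG

end NearHorizon

end

theorem mainTheorem6 {d n N : ℕ} (G : NearHorizon.NHEG d n N) :
    (∃ t r : NearHorizon.Pt d → ℝ, G.IsPoincare t r ∧ ∀ x ∈ G.U, 0 < r x) ∧
    ∀ t r : NearHorizon.Pt d → ℝ, G.IsPoincare t r →
      ∃ (k : Fin n → ℝ) (e : Fin N → ℝ),
        (∀ x ∈ G.U, G.kPot r x = k) ∧
        (∀ p, ∀ x ∈ G.U, G.ePot r p x = e p) ∧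
        (∀ x ∈ G.U, G.nXi (t x) (r x) x = ∑ i, k i • G.m i x) ∧
        ∀ tH rH : ℝ, rH ≠ 0 → ∀ x ∈ G.horizon t r tH rH,
          NearHorizon.surfaceGravity G.g (G.zetaH k tH rH) x = 1 := by
  refine ⟨?_, fun t r hP => ?_⟩
  · obtain ⟨a, b, c, hO⟩ := G.exists_orbitCoeffs
    exact ⟨_, _, hO.isPoincare, fun x hx => inv_pos.2 (Real.sqrt_pos.2 (hO.discr_pos hx))⟩
  · obtain ⟨k, hO⟩ := NearHorizon.NHEG.exists_k hP
    choose e he using hP.exists_ePot hO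
    exact ⟨k, e, fun x hx => hP.kPot_eq hO hx, he, fun x hx => hP.nXi_eq hO hx,
      fun tH rH hrH x hx => hP.surfaceGravity_zetaH hO hrH hx⟩
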